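/- **Source terms.** $t,u ::= x \mid \lambda x_1,\dots,x_n.t \mid t\,u \mid \pi_i t \mid \langle t_1,\dots,t_n\rangle$ with $n\ge 0$ and the $x_j$ pairwise distinct. Size: $|x|=1$, $|\lambda x_1,\dots,x_n.t|=|t|+n+1$, $|t\,u|=|t|+|u|+1$, $|\pi_i t|=|t|+1$, $|\langle t_1,\dots,t_n\rangle|=n+\sum_j|t_j|$. The height $h(t)$ is the maximum number of bound variables of $t$ in the scope of which a sub-term of $t$ is contained. **Closure conversion.** *Wrapping* $\underline{t}$ commutes with all constructors except that $\underline{\lambda\tilde x.t}=[\![\tilde y;\tilde x.\,\underline t\mid\langle\tilde y\rangle]\!]$, where $\tilde y$ is any enumeration without repetitions of the free variables of $\lambda\tilde x.t$. *Name elimination* of an intermediate term with respect to sequences $\tilde y,\tilde x$ maps the variable $y_i$ to the projected variable $\pi_i\mathtt l$ and $x_i$ to $\pi_i\mathtt s$, maps $[\![\tilde z;\tilde w.\,t\mid b]\!]$ to $[\![t'\mid b']\!]$, where $t'$ is the name elimination of $t$ with respect to $\tilde z,\tilde w$ and $b'$ that of $b$ with respect to $\tilde y,\tilde x$, and commutes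 with the other constructors. The closure conversion $\mathrm{cc}(t)$ of a closed source term $t$ is the name elimination of $\underline t$ with respect to two empty sequences. **Target TAM.** Evaluated values are $\bullet[\![t\mid\vec v]\!]$ and $\bullet\langle v_1,\dots,v_n\rangle$, with $\vec v$ a tuple of evaluated values and all $v_j$ evaluated values. A state consists of a focus (a term flagged $\circ$, or an evaluated value, written $v$ below), a constructor stack $S$, an environment $E=(\vec v_{\mathtt l};\vec v_{\mathtt s})$ of two tuples of evaluated values, and an activation stack $A$ of pairs $(S,E)$. The lookup $E(\pi_i\mathtt v)$ is the $i$-th component (counting from $1$) of $\vec v_{\mathtt v}$, if it exists. The initial state for $t$ has focus $\circ t$, empty stacks and two empty tuples as environment. The transitions are (components that are not mentioned do not change): - $\circ(t\,u),\,S\to\circ u,\ \circ t:S$; - $\circ\pi_it,\,S\to\circ t,\ \pi_i:S$; - $\circ\langle t_1,\dots,t_n\rangle,\,S\to\circ t_n,\ \langle t_1,\dots,t_{n-1},\downarrow\rangle:S$ for $n\ge1$; - $\circ\langle\rangle\to\bullet\langle\rangle$; - $\circ[\![t\mid\langle p_1,\dots,p_n\rangle]\!]\to\bullet[\![t\mid\langle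 E(p_1),\dots,E(p_n)\rangle]\!]$ and $\circ p\to E(p)$, for projected variables $p,p_j$, if the lookups are defined; - $v,\ \circ t:S\to\circ t,\ v:S$; - $v,\ \langle\tilde t,t,\downarrow,\tilde v\rangle:S\to\circ t,\ \langle\tilde t,\downarrow,v,\tilde v\rangle:S$; - $v,\ \langle\downarrow,\tilde v\rangle:S\to\bullet\langle v,\tilde v\rangle,\ S$; - $\bullet\langle v_1,\dots,v_n\rangle,\ \pi_i:S\to v_i,\ S$ if $1\le i\le n$; - ($\beta_v$) $\bullet[\![t\mid\vec v]\!],\ \bullet\vec w:S,\ E,\ A\to\circ t,\ \epsilon,\ (\vec v;\vec w),\ (S,E):A$ for a tuple $\vec w$ of evaluated values; - $v,\ \epsilon,\ E,\ (S,E'):A\to v,\ S,\ E',\ A$. A run is *complete* if no transition applies to its last state; $\#\beta_v(\rho)$ is the number of $\beta_v$ transitions of a run $\rho$. **RAM.** A unit-cost random access machine has registers and a memory, and its instructions are: load a constant, addition, truncated subtraction, indirect load and store, conditional jump, halt. States are represented in memory by pointer-linked records with sharing allowed: code and values as trees of records (tuples and bags as arrays), stacks as linked lists, environments as pairs of pointers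 to tuples. **Theorem.** There are a RAM program $P$ and a constant $C$ such that, for every closed source term $t$ and every complete Target TAM run $\rho$ from the initial state for $\mathrm{cc}(t)$, the program $P$, started with the code of $\mathrm{cc}(t)$ in memory, passes in order through representations of all the states of $\rho$ and then halts, in a representation of the last state of $\rho$, after at most $$C\cdot(\#\beta_v(\rho)+1)\cdot(|t|+1)\cdot(h(t)+1)$$ steps. In particular, complete runs on closure conversions of closed source terms $t$ with $|t|,h(t)\ge1$ can be implemented on RAMs in time $O\big((\#\beta_v(\rho)+1)\cdot|t|\cdot h(t)\big)$. -/

import Mathlib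

/-! ## The source calculus -/

/-- Terms of the source calculus: variables (named by natural numbers), abstractions
`λ x₁,…,xₙ. t` over finite sequences of variables, applications, projections `π_i t`
(with `i` counted from 1) and tuples `⟨t₁,…,tₙ⟩`. -/
inductive Src : Type
  | var (x : ℕ)
  | lam (xs : List ℕ) (t : Src)
  | app (t u : Src)
  | proj (i : ℕ) (t : Src)
  | tup (ts : List Src)

namespace Src

mutual
/-- Free variables. -/
def fv : Src → Finset ℕ
  | var x => {x}
  | lam xs t => t.fv \ xs.toFinset
  | app t u => t.fv ∪ u.fv
  | proj _ t => t.fv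
  | tup ts => fvList ts
def fvList : List Src → Finset ℕ
  | [] => ∅
  | t :: ts => t.fv ∪ fvList ts
end

/-- A term is closed when it has no free variables. -/
def Closed (t : Src) : Prop := t.fv = ∅

mutual
/-- The standing convention on abstractions: the variables of a bound sequence are distinct. -/
def Proper : Src → Prop
  | var _ => True
  | lam xs t => xs.Nodup ∧ t.Proper
  | app t u => t.Proper ∧ u.Proper
  | proj _ t => t.Proper
  | tup ts => ProperList ts
def ProperList : List Src → Prop
  | [] => True
  | t :: ts => t.Proper ∧ ProperList ts
end

mutual
/-- The size `|t|`; for tuples, `|⟨t₁,…,tₙ⟩| = n + |t₁| + … + |tₙ|`. -/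
def size : Src → ℕ
  | var _ => 1
  | lam xs t => t.size + xs.length + 1
  | app t u => t.size + u.size + 1
  | proj _ t => t.size + 1
  | tup ts => ts.length + sizeList ts
def sizeList : List Src → ℕ
  | [] => 0
  | t :: ts => t.size + sizeList ts
end

mutual
/-- The height `h(t)`: the maximum number of bound variables of `t` in the scope of which
a sub-term of `t` is contained. -/
def height : Src → ℕ
  | var _ => 0
  | lam xs t => xs.length + t.height
  | app t u => max t.height u.height
  | proj _ t => t.height
  | tup ts => heightList ts
def heightList : List Src → ℕ
  | [] => 0
  | t :: ts => max t.height (heightList ts)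
end

end Src

/-! ## Intermediate terms and wrapping -/

/-- Prime terms of the intermediate calculus. The closure `clos ys xs t b` is
`[ys; xs. t | ⟨b⟩]`: it binds the wrapped variables `ys` and the source variables `xs` in the
body `t` (and not in the bag), and carries a bag `b` of variables. -/
inductive ITm : Type
  | var (x : ℕ)
  | app (t u : ITm)
  | proj (i : ℕ) (t : ITm)
  | tup (ts : List ITm)
  | clos (ys xs : List ℕ) (t : ITm) (b : List ℕ)

/-- `e` enumerates, for each source term, its free variables without repetitions. -/
def Enumerates (e : Src → List ℕ) : Prop :=
  ∀ t : Src, (e t).Nodup ∧ (e t).toFinset = t.fv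

mutual
/-- Wrapping: every abstraction is closed and paired with the bag of its free variables, listed
in the order that `e` gives. -/
def Src.wrap (e : Src → List ℕ) : Src → ITm
  | .var x => .var x
  | .lam xs t => .clos (e (.lam xs t)) xs (Src.wrap e t) (e (.lam xs t))
  | .app t u => .app (Src.wrap e t) (Src.wrap e u)
  | .proj i t => .proj i (Src.wrap e t)
  | .tup ts => .tup (Src.wrapList e ts)
def Src.wrapList (e : Src → List ℕ) : List Src → List ITm
  | [] => []
  | t :: ts => Src.wrap e t :: Src.wrapList e ts
end

/-! ## Target terms and name elimination -/

/-- The two special variables of the target calculus: `l` (wrapped) and `s` (source). -/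
inductive SVar : Type
  | l
  | s
  deriving DecidableEq

/-- Projected variables `π_i l` and `π_i s`, with `i` counted from 1. -/
structure PVar : Type where
  var : SVar
  idx : ℕ

/-- Prime terms of the target calculus. The closure `clos t b` is `[t | ⟨b⟩]`: it binds `l` and
`s` in its body `t` and carries a bag `b` of projected variables. -/
inductive TTm : Type
  | pvar (p : PVar)
  | proj (i : ℕ) (t : TTm)
  | tup (ts : List TTm)
  | app (t u : TTm)
  | clos (t : TTm) (b : List PVar)

/-- The projected variable for `x` with respect to wrapped variables `ys` and source
variables `xs` (meant for `x` in `ys` or in `xs`). -/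
def elimVar (ys xs : List ℕ) (x : ℕ) : PVar :=
  if x ∈ ys then ⟨.l, ys.idxOf x + 1⟩ else ⟨.s, xs.idxOf x + 1⟩

mutual
/-- Name elimination with respect to wrapped variables `ys` and source variables `xs`. -/
def ITm.elim : ITm → List ℕ → List ℕ → TTm
  | .var x, ys, xs => .pvar (elimVar ys xs x)
  | .app t u, ys, xs => .app (ITm.elim t ys xs) (ITm.elim u ys xs)
  | .proj i t, ys, xs => .proj i (ITm.elim t ys xs)
  | .tup ts, ys, xs => .tup (ITm.elimList ts ys xs)
  | .clos zs ws t b, ys, xs => .clos (ITm.elim t zs ws) (b.map (elimVar ys xs))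
def ITm.elimList : List ITm → List ℕ → List ℕ → List TTm
  | [], _, _ => []
  | t :: ts, ys, xs => ITm.elim t ys xs :: ITm.elimList ts ys xs
end

/-- Closure conversion of a closed source term: wrapping followed by name elimination with
empty parameter lists. -/
def Src.closureConversion (e : Src → List ℕ) (t : Src) : TTm :=
  (t.wrap e).elim [] []

/-! ## The Target TAM -/

namespace TTAM

/-- Evaluated values (flag `•`): evaluated closures, made of a non-evaluated body and a bag of
evaluated values, and tuples of evaluated values. -/
inductive Val : Type
  | clos (t : TTm) (bag : List Val)
  | tup (vs : List Val)

/-- Flagged terms: non-evaluated terms (flag `∘`) and evaluated values (flag `•`). -/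
inductive Focus : Type
  | code (t : TTm)
  | val (v : Val)

/-- Entries of constructor stacks; `part ts vs` is the partially evaluated tuple
`⟨ts, ↓, vs⟩`. -/
inductive Entry : Type
  | code (t : TTm)
  | val (v : Val)
  | proj (i : ℕ)
  | part (ts : List TTm) (vs : List Val)

/-- Tupled environments: a tuple of values for `l` and one for `s`. -/
structure Env : Type where
  l : List Val
  s : List Val

/-- Component `i` of a tuple, counted from 1. -/
def component (vs : List Val) (i : ℕ) : Option Val :=
  if i = 0 then none else vs[i - 1]?

/-- Look-up in a tupled environment. -/
def Env.lookup (E : Env) (p : PVar) : Option Val :=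
  match p.var with
  | .l => component E.l p.idx
  | .s => component E.s p.idx

/-- States: focus, constructor stack, environment and activation stack. -/
structure State : Type where
  focus : Focus
  stack : List Entry
  env : Env
  acts : List (List Entry × Env)

/-- Names of the transitions. The principal ones are `beta` and `pi`. -/
inductive Label : Type
  | nsea1 | nsea2 | nsea3 | nsea4 | subw | subv
  | esea1 | esea3 | esea6 | esea7 | pi | beta
  deriving DecidableEq

/-- The transitions of the Target TAM. -/
inductive Step : State → Label → State → Prop
  | nsea1 (t u S E A) :
      Step ⟨.code (.app t u), S, E, A⟩ .nsea1 ⟨.code u, .code t :: S, E, A⟩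
  | nsea2 (i t S E A) :
      Step ⟨.code (.proj i t), S, E, A⟩ .nsea2 ⟨.code t, .proj i :: S, E, A⟩
  | nsea3 (ts t S E A) :
      Step ⟨.code (.tup (ts ++ [t])), S, E, A⟩ .nsea3 ⟨.code t, .part ts [] :: S, E, A⟩
  | nsea4 (S E A) :
      Step ⟨.code (.tup []), S, E, A⟩ .nsea4 ⟨.val (.tup []), S, E, A⟩
  | subw (t b vs S A) (E : Env) (h : List.Forall₂ (fun p v => E.lookup p = some v) b vs) :
      Step ⟨.code (.clos t b), S, E, A⟩ .subw ⟨.val (.clos t vs), S, E, A⟩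
  | subv (p v S A) (E : Env) (h : E.lookup p = some v) :
      Step ⟨.code (.pvar p), S, E, A⟩ .subv ⟨.val v, S, E, A⟩
  | esea1 (v t S E A) :
      Step ⟨.val v, .code t :: S, E, A⟩ .esea1 ⟨.code t, .val v :: S, E, A⟩
  | esea6 (v ts t vs S E A) :
      Step ⟨.val v, .part (ts ++ [t]) vs :: S, E, A⟩ .esea6
        ⟨.code t, .part ts (v :: vs) :: S, E, A⟩
  | esea3 (v vs S E A) :
      Step ⟨.val v, .part [] vs :: S, E, A⟩ .esea3 ⟨.val (.tup (v :: vs)), S, E, A⟩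
  | pi (vs i v S E A) (h : component vs i = some v) :
      Step ⟨.val (.tup vs), .proj i :: S, E, A⟩ .pi ⟨.val v, S, E, A⟩
  | beta (t vs ws S E A) :
      Step ⟨.val (.clos t vs), .val (.tup ws) :: S, E, A⟩ .beta
        ⟨.code t, [], ⟨vs, ws⟩, (S, E) :: A⟩
  | esea7 (v S E E' A) :
      Step ⟨.val v, [], E, (S, E') :: A⟩ .esea7 ⟨.val v, S, E', A⟩

/-- A state is final when no transition applies. -/
def State.Final (s : State) : Prop := ∀ a s', ¬ Step s a s'

/-- The initial state for a target term. -/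
def init (t : TTm) : State := ⟨.code t, [], ⟨[], []⟩, []⟩

/-- Runs (finite sequences of transitions) from `s`; `state k` matters for `k ≤ len` only and
`label k` for `k < len` only. -/
structure Run (s : State) : Type where
  len : ℕ
  state : ℕ → State
  label : ℕ → Label
  start : state 0 = s
  step : ∀ k < len, Step (state k) (label k) (state (k + 1))

/-- The target state of a run. -/
def Run.last {s : State} (ρ : Run s) : State := ρ.state ρ.len

/-- Complete runs are those that end on a final state. -/
def Run.Complete {s : State} (ρ : Run s) : Prop := ρ.last.Final

/-- The number of `beta` transitions of a run. -/
def Run.betas {s : State} (ρ : Run s) : ℕ :=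
  ((Finset.range ρ.len).filter fun k => ρ.label k = .beta).card

end TTAM

/-! ## Random access machines -/

namespace RAM

/-- Instructions of a random access machine; operands are register names, constants and
program addresses. -/
inductive Instr : Type
  /-- `reg d := n` -/
  | const (d n : ℕ)
  /-- `reg d := reg a + reg b` -/
  | add (d a b : ℕ)
  /-- `reg d := reg a - reg b`, truncated at 0 -/
  | sub (d a b : ℕ)
  /-- `reg d := mem (reg a)` -/
  | load (d a : ℕ)
  /-- `mem (reg a) := reg b` -/
  | store (a b : ℕ)
  /-- if `reg a > 0` then jump to instruction number `n` -/
  | jpos (a n : ℕ)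
  | halt

/-- Configurations: program counter, registers and memory. A program refers to finitely many
registers only. -/
structure Config : Type where
  pc : ℕ
  reg : ℕ → ℕ
  mem : ℕ → ℕ

/-- One step of execution; `none` if the machine has halted, which happens on the instruction
`halt` and outside of the program. -/
def step (P : List Instr) (c : Config) : Option Config :=
  match P[c.pc]? with
  | none => none
  | some .halt => none
  | some (.const d n) => some ⟨c.pc + 1, Function.update c.reg d n, c.mem⟩
  | some (.add d a b) => some ⟨c.pc + 1, Function.update c.reg d (c.reg a + c.reg b), c.mem⟩
  | some (.sub d a b) => some ⟨c.pc + 1, Function.update c.reg d (c.reg a - c.reg b), c.mem⟩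
  | some (.load d a) => some ⟨c.pc + 1, Function.update c.reg d (c.mem (c.reg a)), c.mem⟩
  | some (.store a b) => some ⟨c.pc + 1, c.reg, Function.update c.mem (c.reg a) (c.reg b)⟩
  | some (.jpos a n) => some ⟨if 0 < c.reg a then n else c.pc + 1, c.reg, c.mem⟩

/-- The configuration after exactly `n` steps, if the machine does not halt earlier. -/
def exec (P : List Instr) : ℕ → Config → Option Config
  | 0, c => some c
  | n + 1, c => (step P c).bind (exec P n)

/-! ### Representation of terms and states in memory

Objects are records of consecutive cells that refer to each other by address; records may be
shared. In what follows `M` is the memory, `a` the address of the record, and all cells of the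
representation are below `f`. -/

/-- Code of a projected variable: `[0, i]` for `π_i l` and `[1, i]` for `π_i s`. -/
def PVarAt (M : ℕ → ℕ) (f a : ℕ) (p : PVar) : Prop :=
  a + 1 < f ∧ M a = (match p.var with | .l => 0 | .s => 1) ∧ M (a + 1) = p.idx

/-- Code of target terms: `[2, i, addr t]` for `π_i t`, `[3, n, addr t₁, …, addr tₙ]` for tuples,
`[4, addr t, addr u]` for applications and `[5, addr t, n, addr p₁, …, addr pₙ]` for the
closure `[t | ⟨p₁,…,pₙ⟩]`. -/
inductive CodeAt (M : ℕ → ℕ) (f : ℕ) : ℕ → TTm → Prop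
  | pvar (a : ℕ) (p : PVar) : PVarAt M f a p → CodeAt M f a (.pvar p)
  | proj (a i : ℕ) (t : TTm) : a + 2 < f → M a = 2 → M (a + 1) = i →
      CodeAt M f (M (a + 2)) t → CodeAt M f a (.proj i t)
  | tup (a : ℕ) (ts : List TTm) : a + 1 + ts.length < f → M a = 3 → M (a + 1) = ts.length →
      (∀ (k : ℕ) (h : k < ts.length), CodeAt M f (M (a + 2 + k)) ts[k]) →
      CodeAt M f a (.tup ts)
  | app (a : ℕ) (t u : TTm) : a + 2 < f → M a = 4 →
      CodeAt M f (M (a + 1)) t → CodeAt M f (M (a + 2)) u → CodeAt M f a (.app t u)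
  | clos (a : ℕ) (t : TTm) (b : List PVar) : a + 2 + b.length < f → M a = 5 →
      CodeAt M f (M (a + 1)) t → M (a + 2) = b.length →
      (∀ (k : ℕ) (h : k < b.length), PVarAt M f (M (a + 3 + k)) b[k]) →
      CodeAt M f a (.clos t b)

open TTAM

/-- Evaluated values: `[0, addr t, addr bag]` for evaluated closures, where the bag is stored as
a tuple, and `[1, n, addr v₁, …, addr vₙ]` for tuples. -/
inductive ValAt (M : ℕ → ℕ) (f : ℕ) : ℕ → Val → Prop
  | clos (a : ℕ) (t : TTm) (bag : List Val) : a + 2 < f → M a = 0 →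
      CodeAt M f (M (a + 1)) t → ValAt M f (M (a + 2)) (.tup bag) →
      ValAt M f a (.clos t bag)
  | tup (a : ℕ) (vs : List Val) : a + 1 + vs.length < f → M a = 1 → M (a + 1) = vs.length →
      (∀ (k : ℕ) (h : k < vs.length), ValAt M f (M (a + 2 + k)) vs[k]) →
      ValAt M f a (.tup vs)

/-- Linked lists of values: cells `[addr v, next]`, with `0` for the empty list. -/
def ListAt (M : ℕ → ℕ) (f : ℕ) : ℕ → List Val → Prop
  | a, [] => a = 0
  | a, v :: vs => a ≠ 0 ∧ a + 1 < f ∧ ValAt M f (M a) v ∧ ListAt M f (M (a + 1)) vs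

/-- Stack entries, where the cell `a + 1` is left to the link to the rest of the stack:
`[0, _, addr t]` for `∘t`, `[1, _, addr v]` for `•v`, `[2, _, i]` for `π_i`, and
`[3, _, n, d, addr vs]` for `⟨t₁,…,tₙ,↓,vs⟩`, where the cells from `d` on contain
the addresses of `t₁,…,tₙ` and `vs` is stored as a linked list. -/
def EntryAt (M : ℕ → ℕ) (f a : ℕ) : Entry → Prop
  | .code t => a + 2 < f ∧ M a = 0 ∧ CodeAt M f (M (a + 2)) t
  | .val v => a + 2 < f ∧ M a = 1 ∧ ValAt M f (M (a + 2)) v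
  | .proj i => a + 2 < f ∧ M a = 2 ∧ M (a + 2) = i
  | .part ts vs => a + 4 < f ∧ M a = 3 ∧ M (a + 2) = ts.length ∧
      (∀ (k : ℕ) (h : k < ts.length),
        M (a + 3) + k < f ∧ CodeAt M f (M (M (a + 3) + k)) ts[k]) ∧
      ListAt M f (M (a + 4)) vs

/-- Constructor stacks: linked entries, with `0` for the empty stack. -/
def StackAt (M : ℕ → ℕ) (f : ℕ) : ℕ → List Entry → Prop
  | a, [] => a = 0
  | a, en :: S => a ≠ 0 ∧ EntryAt M f a en ∧ StackAt M f (M (a + 1)) S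

/-- Tupled environments: a pair of addresses of tuples. -/
def EnvAt (M : ℕ → ℕ) (f a b : ℕ) (E : Env) : Prop :=
  ValAt M f a (.tup E.l) ∧ ValAt M f b (.tup E.s)

/-- Activation stacks: cells `[next, addr S, addr l-tuple, addr s-tuple]`, with `0` for the
empty stack. -/
def ActsAt (M : ℕ → ℕ) (f : ℕ) : ℕ → List (List Entry × Env) → Prop
  | a, [] => a = 0
  | a, (S, E) :: A => a ≠ 0 ∧ a + 3 < f ∧ StackAt M f (M (a + 1)) S ∧
      EnvAt M f (M (a + 2)) (M (a + 3)) E ∧ ActsAt M f (M a) A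

/-- The focus: its flag (`0` for `∘`, `1` for `•`) and its address. -/
def FocusAt (M : ℕ → ℕ) (f flag a : ℕ) : Focus → Prop
  | .code t => flag = 0 ∧ CodeAt M f a t
  | .val v => flag = 1 ∧ ValAt M f a v

/-- The configuration `c` represents the state `s`: registers 0 and 2 hold the address and the
flag of the focus, register 1 a bound on the memory in use, register 3 the constructor stack,
registers 4 and 5 the environment, and register 6 the activation stack. -/
def Represents (c : Config) (s : State) : Prop :=
  FocusAt c.mem (c.reg 1) (c.reg 2) (c.reg 0) s.focus ∧
  StackAt c.mem (c.reg 1) (c.reg 3) s.stack ∧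
  EnvAt c.mem (c.reg 1) (c.reg 4) (c.reg 5) s.env ∧
  ActsAt c.mem (c.reg 1) (c.reg 6) s.acts

/-- The configuration `c` is ready to start on the target term `t`: the code of `t` is in memory
at the address in register 0, and the memory from the address in register 1 on is free. -/
def Loaded (c : Config) (t : TTm) : Prop :=
  c.pc = 0 ∧ CodeAt c.mem (c.reg 1) (c.reg 0) t

/-- Started on `c₀`, the program `P` implements the run `ρ` in time `T`: it passes through
representations of all the states of `ρ`, in order, and then halts within `T` steps from
the start, in a representation of the target state of `ρ`. -/
def Implements (P : List Instr) (c₀ : Config) {s : State} (ρ : Run s) (T : ℕ) : Prop :=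
  ∃ (τ : ℕ → ℕ) (n : ℕ),
    (∀ k < ρ.len, τ k < τ (k + 1)) ∧ τ ρ.len ≤ n ∧ n ≤ T ∧
    (∀ k ≤ ρ.len, ∃ c, exec P (τ k) c₀ = some c ∧ Represents c (ρ.state k)) ∧
    ∃ c, exec P n c₀ = some c ∧ step P c = none ∧ Represents c ρ.last

end RAM

-- The machine is an interpreter with a bump allocator. Register 1 bounds the memory in use, new
-- records are written from that address on, and no cell below it is ever changed. Hence every
-- representation survives (`CodeAt.mono`, `ValAt.mono`, `StackAt.mono`, ...), code, values, stacks
-- and environments are shared by copying addresses, and simulating a transition only concerns the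
-- fresh records.
--
-- A transition then takes constant time, with two exceptions: evaluating a closure looks up each
-- entry of its bag, and completing a tuple copies the linked list of evaluated components into an
-- array. `stateCost` measures this; `AtState.step` bounds the simulation of a transition by a
-- multiple of it, and `AtState.halts` shows that final states are recognised at the same price.
--
-- These costs are amortised by the potential `State.weight`: by `weight_step` each transition pays
-- for its cost out of the potential, and only `beta` can raise it, by at most the weight of the
-- called body. Called bodies are always subterms of the initial code (`State.BodiesLe.step`), so
-- one bound `B` serves for the whole run, and the time is linear in the initial weight plus `B`
-- times the number of `beta` transitions.
--
-- It remains to bound weights by size times height (`Src.weight_elim_wrap`). The weight of a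
-- closure counts its bag and not its body, and the bag has one entry for each free variable of the
-- abstraction. Inside a closed term, a subterm has at most `h(t)` free variables, because each of
-- them is bound by an enclosing abstraction.

namespace RAM

open TTAM

/-! ## The program -/

/-- A random access machine for the Target TAM. The main loop starts at instruction 13;
registers 7 to 10 hold the constants 0 to 3. -/
def machine : List Instr := [
   -- Constants, an empty tuple for both environments, and empty stacks.
   .const 7 0, .const 8 1, .const 9 2, .const 10 3, .store 1 8, .add 11 1 8, .store 11 7,
   -- Register 7 holds 0, so `.add d a 7` copies a register; register 8 holds 1, so `.jpos 8 n` is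
   -- an unconditional jump. Both environments share one empty tuple. Below, tags are told apart by
   -- repeated decrement, and instruction 24 is a `halt` shared by several failed tests.
   .add 4 1 7, .add 5 1 7, .add 1 1 9, .const 2 0, .const 3 0, .const 6 0,
   -- Main loop: dispatch on the flag of the focus.
   .jpos 2 124, .load 11 0, .jpos 11 18, .add 12 4 7, .jpos 8 21, .sub 11 11 8, .jpos 11 33,
   .add 12 5 7,
   -- Projected variable: look-up in the tuple in register 12.
   .add 13 0 8, .load 13 13, .jpos 13 25, .halt, .add 14 12 8, .load 15 14, .sub 15 13 15,
   .jpos 15 24, .add 14 14 13, .load 0 14, .const 2 1, .jpos 8 13, .sub 11 11 8, .jpos 11 48,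
   -- Projection.
   .add 12 0 8, .load 13 12, .add 12 12 8, .load 0 12, .add 14 9 7,
   -- Push the entry with tag in register 14 and content in register 13.
   .store 1 14, .add 12 1 8, .store 12 3, .add 12 12 8, .store 12 13, .add 3 1 7,
   .add 1 1 10, .jpos 8 13, .sub 11 11 8, .jpos 11 76,
   -- Tuple.
   .add 12 0 8, .load 13 12, .jpos 13 60, .store 1 8, .add 12 1 8, .store 12 7, .add 0 1 7,
   .const 2 1, .add 1 1 9, .jpos 8 13, .add 14 12 8, .add 12 12 13, .load 0 12, .sub 13 13 8,
   .store 1 10, .add 12 1 8, .store 12 3, .add 12 12 8, .store 12 13, .add 12 12 8,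
   .store 12 14, .add 12 12 8, .store 12 7, .add 3 1 7, .add 1 12 8, .jpos 8 13,
   .sub 11 11 8, .jpos 11 84,
   -- Application.
   .add 12 0 8, .load 13 12, .add 12 12 8, .load 0 12, .const 14 0, .jpos 8 40,
   -- Closure: evaluate the bag into a fresh tuple, then make the record.
   .add 12 0 9, .load 16 12, .add 17 12 8, .store 1 8, .add 12 1 8, .store 12 16,
   .add 18 1 9, .jpos 16 103, .add 13 0 8, .load 13 13, .store 18 7, .add 12 18 8,
   .store 12 13, .add 12 12 8, .store 12 1, .add 0 18 7, .const 2 1, .add 1 12 8, .jpos 8 13,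
   .load 19 17, .load 11 19, .jpos 11 108, .add 12 4 7, .jpos 8 109, .add 12 5 7,
   .add 13 19 8, .load 13 13, .jpos 13 113, .halt, .add 14 12 8, .load 15 14, .sub 15 13 15,
   .jpos 15 24, .add 14 14 13, .load 15 14, .store 18 15, .add 17 17 8, .add 18 18 8,
   .sub 16 16 8, .jpos 8 91, .jpos 3 135, .jpos 6 127, .halt,
   -- Value with empty constructor stack: pop the activation stack.
   .add 11 6 8, .load 3 11, .add 11 11 8, .load 4 11, .add 11 11 8, .load 5 11, .load 6 6,
   .jpos 8 13,
   -- Value with a stack entry: dispatch on the tag of the entry.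
   .add 20 3 8, .add 21 3 9, .load 11 3, .jpos 11 145, .add 13 0 7, .load 0 21, .load 3 20,
   .const 2 0, .const 14 1, .jpos 8 40, .sub 11 11 8, .jpos 11 172,
   -- Application of a closure to a tuple.
   .load 12 0, .jpos 12 24, .load 12 21, .load 13 12, .jpos 13 153, .halt, .load 13 20,
   .add 14 0 8, .add 15 14 8, .load 0 14, .load 14 15, .store 1 6, .add 15 1 8, .store 15 13,
   .add 15 15 8, .store 15 4, .add 15 15 8, .store 15 5, .add 6 1 7, .add 1 15 8,
   .add 4 14 7, .add 5 12 7, .const 3 0, .const 2 0, .jpos 8 13, .sub 11 11 8, .jpos 11 188,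
   -- Projection of a tuple.
   .load 12 0, .jpos 12 177, .halt, .load 13 21, .jpos 13 180, .halt, .add 14 0 8,
   .load 15 14, .sub 15 13 15, .jpos 15 24, .add 14 14 13, .load 0 14, .load 3 20,
   .jpos 8 13,
   -- Partially evaluated tuple.
   .load 13 21, .add 21 21 8, .add 22 21 8, .load 15 22, .load 20 20, .jpos 13 212,
   .store 1 8, .add 12 1 9, .store 12 0, .add 18 12 8, .jpos 15 206, .sub 12 18 12,
   .add 11 1 8, .store 11 12, .add 0 1 7, .add 1 18 7, .add 3 20 7, .jpos 8 13, .load 11 15,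
   .store 18 11, .add 18 18 8, .add 15 15 8, .load 15 15, .jpos 8 198, .load 14 21,
   .sub 13 13 8, .add 16 14 13, .load 16 16, .store 1 0, .add 12 1 8, .store 12 15,
   .add 12 12 8, .add 3 12 7, .store 12 10, .add 12 12 8, .store 12 20, .add 12 12 8,
   .store 12 13, .add 12 12 8, .store 12 14, .add 12 12 8, .store 12 1, .add 1 12 8,
   .add 0 16 7, .const 2 0, .jpos 8 13]

-- Step-counted reachability

/-- The effect of an instruction, with `halt` left without effect. -/
def Instr.next : Instr → Config → Config
  | .const d n, c => ⟨c.pc + 1, Function.update c.reg d n, c.mem⟩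
  | .add d a b, c => ⟨c.pc + 1, Function.update c.reg d (c.reg a + c.reg b), c.mem⟩
  | .sub d a b, c => ⟨c.pc + 1, Function.update c.reg d (c.reg a - c.reg b), c.mem⟩
  | .load d a, c => ⟨c.pc + 1, Function.update c.reg d (c.mem (c.reg a)), c.mem⟩
  | .store a b, c => ⟨c.pc + 1, c.reg, Function.update c.mem (c.reg a) (c.reg b)⟩
  | .jpos a n, c => ⟨if 0 < c.reg a then n else c.pc + 1, c.reg, c.mem⟩
  | .halt, c => c

/-- Within `K` steps, `machine` goes from `c` to a configuration that satisfies `Q`. -/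
def Reaches (K : ℕ) (c : Config) (Q : Config → Prop) : Prop :=
  ∃ n ≤ K, ∃ c', exec machine n c = some c' ∧ Q c'

theorem Reaches.refl {K : ℕ} {c : Config} {Q : Config → Prop} (h : Q c) : Reaches K c Q :=
  ⟨0, Nat.zero_le _, c, rfl, h⟩

theorem step_eq_next {P : List Instr} {c : Config} {i : Instr} (hi : P[c.pc]? = some i)
    (h : i ≠ .halt) : step P c = some (i.next c) := by
  unfold step
  rw [hi]
  cases i <;> first | rfl | exact absurd rfl h

theorem Reaches.next {K : ℕ} {pc : ℕ} {R M : ℕ → ℕ} {Q : Config → Prop} {i : Instr}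
    (hi : machine[pc]? = some i) (h : Reaches K (i.next ⟨pc, R, M⟩) Q) :
    Reaches (K + 1) ⟨pc, R, M⟩ Q := by
  obtain ⟨n, hn, c', he, hQ⟩ := h
  -- Since `next` is the identity on `halt`, the claim also holds there, and symbolic execution
  -- needs no side condition on the instruction.
  by_cases hh : i = .halt
  · subst hh
    exact ⟨n, by omega, c', he, hQ⟩
  · refine ⟨n + 1, by omega, c', ?_, hQ⟩
    simp only [exec]
    rw [step_eq_next (c := ⟨pc, R, M⟩) hi hh]
    exact he

theorem exec_add (P : List Instr) (m n : ℕ) (c : Config) :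
    exec P (m + n) c = (exec P m c).bind (exec P n) := by
  induction m generalizing c with
  | zero => simp [exec]
  | succ m ih =>
    rw [Nat.succ_add]
    simp only [exec]
    cases step P c with
    | none => rfl
    | some c' => exact ih c'

theorem Reaches.trans {K L : ℕ} {c : Config} {Q Q' : Config → Prop} (h : Reaches K c Q)
    (h' : ∀ c', Q c' → Reaches L c' Q') : Reaches (K + L) c Q' := by
  obtain ⟨n, hn, c', he, hQ⟩ := h
  obtain ⟨m, hm, c'', he', hQ'⟩ := h' c' hQ
  exact ⟨n + m, by omega, c'', by rw [exec_add, he]; exact he', hQ'⟩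

theorem Reaches.mono {K L : ℕ} {c : Config} {Q Q' : Config → Prop} (h : Reaches K c Q)
    (hKL : K ≤ L) (hQ : ∀ c', Q c' → Q' c') : Reaches L c Q' := by
  obtain ⟨n, hn, c', he, hq⟩ := h
  exact ⟨n, hn.trans hKL, c', he, hQ c' hq⟩

set_option linter.unusedSimpArgs false

/-! ## Execution of the blocks of the program -/

/-- The registers of a state (registers 0 to 6), and the constants in registers 7 to 10. -/
def Regs (R : ℕ → ℕ) (a f fl S l s A : ℕ) : Prop :=
  R 0 = a ∧ R 1 = f ∧ R 2 = fl ∧ R 3 = S ∧ R 4 = l ∧ R 5 = s ∧ R 6 = A ∧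
    R 7 = 0 ∧ R 8 = 1 ∧ R 9 = 2 ∧ R 10 = 3

/-- At the start of the main loop, with the given registers. -/
def Ready (c : Config) (a f fl S l s A : ℕ) : Prop :=
  c.pc = 13 ∧ Regs c.reg a f fl S l s A

/-- Halted, with the given registers. -/
def Halted (c : Config) (a f fl S l s A : ℕ) : Prop :=
  step machine c = none ∧ Regs c.reg a f fl S l s A

section Blocks

variable {R M : ℕ → ℕ} {a f fl S l s A : ℕ}

theorem reaches_init (h0 : R 0 = a) (h1 : R 1 = f) :
    Reaches 13 ⟨0, R, M⟩ fun c => Ready c a (f + 2) 0 0 f f 0 ∧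
      c.mem = Function.update (Function.update M f 1) (f + 1) 0 := by
  -- Symbolic execution: the program counter is a literal, so `rfl` fetches the instruction, and
  -- `simp` normalises the updated registers and memory. In these lemmas the iteration count is the
  -- number of instructions executed, while the bound on steps is usually rounded up.
  iterate 13
    refine Reaches.next rfl ?_
    simp only [Instr.next, Function.update_apply, Nat.reduceAdd, Nat.reduceEqDiff, Nat.reduceSub,
      reduceIte, OfNat.ofNat_ne_zero, Nat.reduceLT, Nat.add_assoc, Nat.add_zero, *]
  exact Reaches.refl (by simp [Ready, Regs, Function.update_apply, *])

-- Blocks for a focus that is code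

theorem reaches_app (h : Regs R a f fl S l s A) (ht : M a = 4) :
    Reaches 40 ⟨14, R, M⟩ fun c => Ready c (M (a + 2)) (f + 3) fl f l s A ∧
      c.mem = Function.update (Function.update (Function.update M f 0) (f + 1) S) (f + 2)
        (M (a + 1)) := by
  obtain ⟨h0, h1, h2, h3, h4, h5, h6, h7, h8, h9, h10⟩ := h
  iterate 24
    refine Reaches.next rfl ?_
    simp only [Instr.next, Function.update_apply, Nat.reduceAdd, Nat.reduceEqDiff, Nat.reduceSub,
      reduceIte, OfNat.ofNat_ne_zero, Nat.reduceLT, Nat.add_assoc, Nat.add_zero, *]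
  exact Reaches.refl (by simp [Ready, Regs, Function.update_apply, *])

theorem reaches_proj (h : Regs R a f fl S l s A) (ht : M a = 2) :
    Reaches 40 ⟨14, R, M⟩ fun c => Ready c (M (a + 2)) (f + 3) fl f l s A ∧
      c.mem = Function.update (Function.update (Function.update M f 2) (f + 1) S) (f + 2)
        (M (a + 1)) := by
  obtain ⟨h0, h1, h2, h3, h4, h5, h6, h7, h8, h9, h10⟩ := h
  iterate 19
    refine Reaches.next rfl ?_
    simp only [Instr.next, Function.update_apply, Nat.reduceAdd, Nat.reduceEqDiff, Nat.reduceSub,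
      reduceIte, OfNat.ofNat_ne_zero, Nat.reduceLT, Nat.add_assoc, Nat.add_zero, *]
  exact Reaches.refl (by simp [Ready, Regs, Function.update_apply, *])

theorem reaches_tup_nil (h : Regs R a f fl S l s A) (ht : M a = 3) (hn : M (a + 1) = 0) :
    Reaches 40 ⟨14, R, M⟩ fun c => Ready c f (f + 2) 1 S l s A ∧
      c.mem = Function.update (Function.update M f 1) (f + 1) 0 := by
  obtain ⟨h0, h1, h2, h3, h4, h5, h6, h7, h8, h9, h10⟩ := h
  iterate 18
    refine Reaches.next rfl ?_
    simp only [Instr.next, Function.update_apply, Nat.reduceAdd, Nat.reduceEqDiff, Nat.reduceSub,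
      reduceIte, OfNat.ofNat_ne_zero, Nat.reduceLT, Nat.add_assoc, Nat.add_zero, Nat.lt_irrefl, *]
  exact Reaches.refl (by simp [Ready, Regs, Function.update_apply, *])

/-- The new stack entry points into the code record itself, at the array of components starting at
`a + 2`. Nothing is copied, so the time does not depend on the number of components. -/
theorem reaches_tup_succ {n : ℕ} (h : Regs R a f fl S l s A) (ht : M a = 3)
    (hn : M (a + 1) = n + 1) :
    Reaches 60 ⟨14, R, M⟩ fun c => Ready c (M (a + (n + 2))) (f + 5) fl f l s A ∧
      c.mem = Function.update (Function.update (Function.update (Function.update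
        (Function.update M f 3) (f + 1) S) (f + 2) n) (f + 3) (a + 2)) (f + 4) 0 := by
  obtain ⟨h0, h1, h2, h3, h4, h5, h6, h7, h8, h9, h10⟩ := h
  have e : ∀ m, a + (1 + (m + 1)) = a + (m + 2) := fun m => by omega
  iterate 27
    refine Reaches.next rfl ?_
    simp only [Instr.next, Function.update_apply, Nat.reduceAdd, Nat.reduceEqDiff, Nat.reduceSub,
      reduceIte, OfNat.ofNat_ne_zero, Nat.reduceLT, Nat.add_assoc, Nat.add_zero,
      Nat.zero_lt_succ, Nat.add_sub_cancel, *]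
  exact Reaches.refl (by simp [Ready, Regs, Function.update_apply, *])

/-- `T` is the tuple selected by the tag of the variable. Since subtraction is truncated, a zero
difference of index and length says that the index is in range. -/
theorem reaches_var {T : ℕ} (h : Regs R a f fl S l s A)
    (hT : M a = 0 ∧ T = l ∨ M a = 1 ∧ T = s) (hi : 0 < M (a + 1))
    (hn : M (a + 1) - M (T + 1) = 0) :
    Reaches 40 ⟨14, R, M⟩ fun c => Ready c (M (T + (1 + M (a + 1)))) f 1 S l s A ∧
      c.mem = M := by
  obtain ⟨h0, h1, h2, h3, h4, h5, h6, h7, h8, h9, h10⟩ := h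
  obtain ⟨ht, rfl⟩ | ⟨ht, rfl⟩ := hT
  · iterate 15
      refine Reaches.next rfl ?_
      simp only [Instr.next, Function.update_apply, Nat.reduceAdd, Nat.reduceEqDiff,
        Nat.reduceSub, reduceIte, OfNat.ofNat_ne_zero, Nat.reduceLT, Nat.add_assoc, Nat.add_zero,
        Nat.lt_irrefl, *]
    exact Reaches.refl (by simp [Ready, Regs, Function.update_apply, *])
  · iterate 16
      refine Reaches.next rfl ?_
      simp only [Instr.next, Function.update_apply, Nat.reduceAdd, Nat.reduceEqDiff,
        Nat.reduceSub, reduceIte, OfNat.ofNat_ne_zero, Nat.reduceLT, Nat.add_assoc, Nat.add_zero,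
        Nat.lt_irrefl, *]
    exact Reaches.refl (by simp [Ready, Regs, Function.update_apply, *])

theorem reaches_var_halt {T : ℕ} (h : Regs R a f fl S l s A)
    (hT : M a = 0 ∧ T = l ∨ M a = 1 ∧ T = s)
    (hi : M (a + 1) = 0 ∨ 0 < M (a + 1) ∧ 0 < M (a + 1) - M (T + 1)) :
    Reaches 40 ⟨14, R, M⟩ fun c => Halted c a f fl S l s A ∧ c.mem = M := by
  obtain ⟨h0, h1, h2, h3, h4, h5, h6, h7, h8, h9, h10⟩ := h
  obtain ⟨ht, rfl⟩ | ⟨ht, rfl⟩ := hT <;> obtain hi | ⟨hi, hn⟩ := hi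
  · iterate 7
      refine Reaches.next rfl ?_
      simp only [Instr.next, Function.update_apply, Nat.reduceAdd, Nat.reduceEqDiff,
        Nat.reduceSub, reduceIte, OfNat.ofNat_ne_zero, Nat.reduceLT, Nat.add_assoc, Nat.add_zero,
        Nat.lt_irrefl, *]
    refine Reaches.refl ⟨⟨rfl, ?_⟩, rfl⟩
    simp [Regs, Function.update_apply, *]
  · iterate 11
      refine Reaches.next rfl ?_
      simp only [Instr.next, Function.update_apply, Nat.reduceAdd, Nat.reduceEqDiff,
        Nat.reduceSub, reduceIte, OfNat.ofNat_ne_zero, Nat.reduceLT, Nat.add_assoc, Nat.add_zero,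
        Nat.lt_irrefl, *]
    refine Reaches.refl ⟨⟨rfl, ?_⟩, rfl⟩
    simp [Regs, Function.update_apply, *]
  · iterate 8
      refine Reaches.next rfl ?_
      simp only [Instr.next, Function.update_apply, Nat.reduceAdd, Nat.reduceEqDiff,
        Nat.reduceSub, reduceIte, OfNat.ofNat_ne_zero, Nat.reduceLT, Nat.add_assoc, Nat.add_zero,
        Nat.lt_irrefl, *]
    refine Reaches.refl ⟨⟨rfl, ?_⟩, rfl⟩
    simp [Regs, Function.update_apply, *]
  · iterate 12
      refine Reaches.next rfl ?_
      simp only [Instr.next, Function.update_apply, Nat.reduceAdd, Nat.reduceEqDiff,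
        Nat.reduceSub, reduceIte, OfNat.ofNat_ne_zero, Nat.reduceLT, Nat.add_assoc, Nat.add_zero,
        Nat.lt_irrefl, *]
    refine Reaches.refl ⟨⟨rfl, ?_⟩, rfl⟩
    simp [Regs, Function.update_apply, *]

theorem reaches_clos (h : Regs R a f fl S l s A) (ht : M a = 5) :
    Reaches 40 ⟨14, R, M⟩ fun c => c.pc = 91 ∧ Regs c.reg a f fl S l s A ∧
      c.reg 16 = M (a + 2) ∧ c.reg 17 = a + 3 ∧ c.reg 18 = f + 2 ∧
      c.mem = Function.update (Function.update M f 1) (f + 1) (M (a + 2)) := by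
  obtain ⟨h0, h1, h2, h3, h4, h5, h6, h7, h8, h9, h10⟩ := h
  iterate 17
    refine Reaches.next rfl ?_
    simp only [Instr.next, Function.update_apply, Nat.reduceAdd, Nat.reduceEqDiff, Nat.reduceSub,
      reduceIte, OfNat.ofNat_ne_zero, Nat.reduceLT, Nat.add_assoc, Nat.add_zero, Nat.lt_irrefl, *]
  exact Reaches.refl (by simp [Regs, Function.update_apply, *])

theorem reaches_bag_done (h : Regs R a f fl S l s A) (hn : R 16 = 0) :
    Reaches 40 ⟨91, R, M⟩ fun c =>
      Ready c (R 18) (R 18 + 3) 1 S l s A ∧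
      c.mem = Function.update (Function.update (Function.update M (R 18) 0) (R 18 + 1) (M (a + 1)))
        (R 18 + 2) f := by
  obtain ⟨h0, h1, h2, h3, h4, h5, h6, h7, h8, h9, h10⟩ := h
  iterate 12
    refine Reaches.next rfl ?_
    simp only [Instr.next, Function.update_apply, Nat.reduceAdd, Nat.reduceEqDiff, Nat.reduceSub,
      reduceIte, OfNat.ofNat_ne_zero, Nat.reduceLT, Nat.add_assoc, Nat.add_zero, Nat.lt_irrefl, *]
  exact Reaches.refl (by simp [Ready, Regs, Function.update_apply, *])

/-- One iteration of the bag loop: register 16 counts the remaining entries, register 17 reads the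
bag and register 18 writes the new tuple. Register 1 keeps its old value until the closure is
complete. -/
theorem reaches_bag_succ {T n p d q : ℕ} (h : Regs R a f fl S l s A) (hn : R 16 = n + 1)
    (hp : R 17 = p) (hd : R 18 = d) (hq : M p = q) (hT : M q = 0 ∧ T = l ∨ M q = 1 ∧ T = s)
    (hi : 0 < M (q + 1)) (hl : M (q + 1) - M (T + 1) = 0) :
    Reaches 30 ⟨91, R, M⟩ fun c => c.pc = 91 ∧ Regs c.reg a f fl S l s A ∧
      c.reg 16 = n ∧ c.reg 17 = p + 1 ∧ c.reg 18 = d + 1 ∧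
      c.mem = Function.update M d (M (T + (1 + M (q + 1)))) := by
  obtain ⟨h0, h1, h2, h3, h4, h5, h6, h7, h8, h9, h10⟩ := h
  obtain ⟨ht, rfl⟩ | ⟨ht, rfl⟩ := hT
  · iterate 20
      refine Reaches.next rfl ?_
      simp only [Instr.next, Function.update_apply, Nat.reduceAdd, Nat.reduceEqDiff,
        Nat.reduceSub, reduceIte, OfNat.ofNat_ne_zero, Nat.reduceLT, Nat.add_assoc, Nat.add_zero,
        Nat.lt_irrefl, Nat.zero_lt_succ, Nat.add_sub_cancel, *]
    exact Reaches.refl (by simp [Regs, Function.update_apply, *])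
  · iterate 19
      refine Reaches.next rfl ?_
      simp only [Instr.next, Function.update_apply, Nat.reduceAdd, Nat.reduceEqDiff,
        Nat.reduceSub, reduceIte, OfNat.ofNat_ne_zero, Nat.reduceLT, Nat.add_assoc, Nat.add_zero,
        Nat.lt_irrefl, Nat.zero_lt_succ, Nat.add_sub_cancel, *]
    exact Reaches.refl (by simp [Regs, Function.update_apply, *])

theorem reaches_bag_halt {T n p q : ℕ} (h : Regs R a f fl S l s A) (hn : R 16 = n + 1)
    (hp : R 17 = p) (hq : M p = q) (hT : M q = 0 ∧ T = l ∨ M q = 1 ∧ T = s)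
    (hi : M (q + 1) = 0 ∨ 0 < M (q + 1) ∧ 0 < M (q + 1) - M (T + 1)) :
    Reaches 30 ⟨91, R, M⟩ fun c => Halted c a f fl S l s A ∧ c.mem = M := by
  obtain ⟨h0, h1, h2, h3, h4, h5, h6, h7, h8, h9, h10⟩ := h
  obtain ⟨ht, rfl⟩ | ⟨ht, rfl⟩ := hT <;> obtain hi | ⟨hi, hl⟩ := hi
  · iterate 9
      refine Reaches.next rfl ?_
      simp only [Instr.next, Function.update_apply, Nat.reduceAdd, Nat.reduceEqDiff,
        Nat.reduceSub, reduceIte, OfNat.ofNat_ne_zero, Nat.reduceLT, Nat.add_assoc, Nat.add_zero,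
        Nat.lt_irrefl, Nat.zero_lt_succ, *]
    refine Reaches.refl ⟨⟨rfl, ?_⟩, rfl⟩
    simp [Regs, Function.update_apply, *]
  · iterate 13
      refine Reaches.next rfl ?_
      simp only [Instr.next, Function.update_apply, Nat.reduceAdd, Nat.reduceEqDiff,
        Nat.reduceSub, reduceIte, OfNat.ofNat_ne_zero, Nat.reduceLT, Nat.add_assoc, Nat.add_zero,
        Nat.lt_irrefl, Nat.zero_lt_succ, *]
    refine Reaches.refl ⟨⟨rfl, ?_⟩, rfl⟩
    simp [Regs, Function.update_apply, *]
  · iterate 8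
      refine Reaches.next rfl ?_
      simp only [Instr.next, Function.update_apply, Nat.reduceAdd, Nat.reduceEqDiff,
        Nat.reduceSub, reduceIte, OfNat.ofNat_ne_zero, Nat.reduceLT, Nat.add_assoc, Nat.add_zero,
        Nat.lt_irrefl, Nat.zero_lt_succ, *]
    refine Reaches.refl ⟨⟨rfl, ?_⟩, rfl⟩
    simp [Regs, Function.update_apply, *]
  · iterate 12
      refine Reaches.next rfl ?_
      simp only [Instr.next, Function.update_apply, Nat.reduceAdd, Nat.reduceEqDiff,
        Nat.reduceSub, reduceIte, OfNat.ofNat_ne_zero, Nat.reduceLT, Nat.add_assoc, Nat.add_zero,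
        Nat.lt_irrefl, Nat.zero_lt_succ, *]
    refine Reaches.refl ⟨⟨rfl, ?_⟩, rfl⟩
    simp [Regs, Function.update_apply, *]

-- Blocks for a focus that is a value

theorem reaches_val_nil_halt (h : Regs R a f fl S l s A) (hS : S = 0) (hA : A = 0) :
    Reaches 40 ⟨124, R, M⟩ fun c => Halted c a f fl S l s A ∧ c.mem = M := by
  obtain ⟨h0, h1, h2, h3, h4, h5, h6, h7, h8, h9, h10⟩ := h
  subst hS hA
  iterate 2
    refine Reaches.next rfl ?_
    simp only [Instr.next, Function.update_apply, Nat.reduceAdd, Nat.reduceEqDiff, Nat.reduceSub,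
      reduceIte, OfNat.ofNat_ne_zero, Nat.reduceLT, Nat.add_assoc, Nat.add_zero, Nat.lt_irrefl, *]
  refine Reaches.refl ⟨⟨rfl, ?_⟩, rfl⟩
  simp [Regs, Function.update_apply, *]

theorem reaches_val_pop (h : Regs R a f fl S l s A) (hS : S = 0) (hA : 0 < A) :
    Reaches 40 ⟨124, R, M⟩ fun c =>
      Ready c a f fl (M (A + 1)) (M (A + 2)) (M (A + 3)) (M A) ∧ c.mem = M := by
  obtain ⟨h0, h1, h2, h3, h4, h5, h6, h7, h8, h9, h10⟩ := h
  subst hS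
  iterate 10
    refine Reaches.next rfl ?_
    simp only [Instr.next, Function.update_apply, Nat.reduceAdd, Nat.reduceEqDiff, Nat.reduceSub,
      reduceIte, OfNat.ofNat_ne_zero, Nat.reduceLT, Nat.add_assoc, Nat.add_zero, Nat.lt_irrefl, *]
  exact Reaches.refl (by simp [Ready, Regs, Function.update_apply, *])

theorem reaches_val_code (h : Regs R a f fl S l s A) (hS : 0 < S) (ht : M S = 0) :
    Reaches 40 ⟨124, R, M⟩ fun c =>
      Ready c (M (S + 2)) (f + 3) 0 f l s A ∧
      c.mem = Function.update (Function.update (Function.update M f 1) (f + 1) (M (S + 1)))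
        (f + 2) a := by
  obtain ⟨h0, h1, h2, h3, h4, h5, h6, h7, h8, h9, h10⟩ := h
  iterate 19
    refine Reaches.next rfl ?_
    simp only [Instr.next, Function.update_apply, Nat.reduceAdd, Nat.reduceEqDiff, Nat.reduceSub,
      reduceIte, OfNat.ofNat_ne_zero, Nat.reduceLT, Nat.add_assoc, Nat.add_zero, Nat.lt_irrefl, *]
  exact Reaches.refl (by simp [Ready, Regs, Function.update_apply, *])

theorem reaches_val_beta (h : Regs R a f fl S l s A) (hS : 0 < S) (ht : M S = 1) (hc : M a = 0)
    (hw : M (M (S + 2)) = 1) :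
    Reaches 60 ⟨124, R, M⟩ fun c =>
      Ready c (M (a + 1)) (f + 4) 0 0 (M (a + 2)) (M (S + 2)) f ∧
      c.mem = Function.update (Function.update (Function.update (Function.update M f A)
        (f + 1) (M (S + 1))) (f + 2) l) (f + 3) s := by
  obtain ⟨h0, h1, h2, h3, h4, h5, h6, h7, h8, h9, h10⟩ := h
  iterate 31
    refine Reaches.next rfl ?_
    simp only [Instr.next, Function.update_apply, Nat.reduceAdd, Nat.reduceEqDiff, Nat.reduceSub,
      reduceIte, OfNat.ofNat_ne_zero, Nat.reduceLT, Nat.add_assoc, Nat.add_zero, Nat.lt_irrefl, *]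
  exact Reaches.refl (by simp [Ready, Regs, Function.update_apply, *])

theorem reaches_val_beta_halt (h : Regs R a f fl S l s A) (hS : 0 < S) (ht : M S = 1)
    (hc : 0 < M a ∨ M a = 0 ∧ M (M (S + 2)) = 0) :
    Reaches 40 ⟨124, R, M⟩ fun c => Halted c a f fl S l s A ∧ c.mem = M := by
  obtain ⟨h0, h1, h2, h3, h4, h5, h6, h7, h8, h9, h10⟩ := h
  obtain hc | ⟨hc, hw⟩ := hc
  · iterate 9
      refine Reaches.next rfl ?_
      simp only [Instr.next, Function.update_apply, Nat.reduceAdd, Nat.reduceEqDiff,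
        Nat.reduceSub, reduceIte, OfNat.ofNat_ne_zero, Nat.reduceLT, Nat.add_assoc, Nat.add_zero,
        Nat.lt_irrefl, *]
    refine Reaches.refl ⟨⟨rfl, ?_⟩, rfl⟩
    simp [Regs, Function.update_apply, *]
  · iterate 12
      refine Reaches.next rfl ?_
      simp only [Instr.next, Function.update_apply, Nat.reduceAdd, Nat.reduceEqDiff,
        Nat.reduceSub, reduceIte, OfNat.ofNat_ne_zero, Nat.reduceLT, Nat.add_assoc, Nat.add_zero,
        Nat.lt_irrefl, *]
    refine Reaches.refl ⟨⟨rfl, ?_⟩, rfl⟩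
    simp [Regs, Function.update_apply, *]

theorem reaches_val_pi (h : Regs R a f fl S l s A) (hS : 0 < S) (ht : M S = 2) (hc : 0 < M a)
    (hi : 0 < M (S + 2)) (hl : M (S + 2) - M (a + 1) = 0) :
    Reaches 40 ⟨124, R, M⟩ fun c =>
      Ready c (M (a + (1 + M (S + 2)))) f fl (M (S + 1)) l s A ∧ c.mem = M := by
  obtain ⟨h0, h1, h2, h3, h4, h5, h6, h7, h8, h9, h10⟩ := h
  iterate 21
    refine Reaches.next rfl ?_
    simp only [Instr.next, Function.update_apply, Nat.reduceAdd, Nat.reduceEqDiff, Nat.reduceSub,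
      reduceIte, OfNat.ofNat_ne_zero, Nat.reduceLT, Nat.add_assoc, Nat.add_zero, Nat.lt_irrefl, *]
  exact Reaches.refl (by simp [Ready, Regs, Function.update_apply, *])

theorem reaches_val_pi_halt (h : Regs R a f fl S l s A) (hS : 0 < S) (ht : M S = 2)
    (hc : M a = 0 ∨ 0 < M a ∧ (M (S + 2) = 0 ∨ 0 < M (S + 2) ∧ 0 < M (S + 2) - M (a + 1))) :
    Reaches 40 ⟨124, R, M⟩ fun c => Halted c a f fl S l s A ∧ c.mem = M := by
  obtain ⟨h0, h1, h2, h3, h4, h5, h6, h7, h8, h9, h10⟩ := h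
  obtain hc | ⟨hc, hi | ⟨hi, hl⟩⟩ := hc
  · iterate 11
      refine Reaches.next rfl ?_
      simp only [Instr.next, Function.update_apply, Nat.reduceAdd, Nat.reduceEqDiff,
        Nat.reduceSub, reduceIte, OfNat.ofNat_ne_zero, Nat.reduceLT, Nat.add_assoc, Nat.add_zero,
        Nat.lt_irrefl, *]
    refine Reaches.refl ⟨⟨rfl, ?_⟩, rfl⟩
    simp [Regs, Function.update_apply, *]
  · iterate 13
      refine Reaches.next rfl ?_
      simp only [Instr.next, Function.update_apply, Nat.reduceAdd, Nat.reduceEqDiff,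
        Nat.reduceSub, reduceIte, OfNat.ofNat_ne_zero, Nat.reduceLT, Nat.add_assoc, Nat.add_zero,
        Nat.lt_irrefl, *]
    refine Reaches.refl ⟨⟨rfl, ?_⟩, rfl⟩
    simp [Regs, Function.update_apply, *]
  · iterate 17
      refine Reaches.next rfl ?_
      simp only [Instr.next, Function.update_apply, Nat.reduceAdd, Nat.reduceEqDiff,
        Nat.reduceSub, reduceIte, OfNat.ofNat_ne_zero, Nat.reduceLT, Nat.add_assoc, Nat.add_zero,
        Nat.lt_irrefl, *]
    refine Reaches.refl ⟨⟨rfl, ?_⟩, rfl⟩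
    simp [Regs, Function.update_apply, *]

/-- The length cell `f + 1` of the new tuple is left unset, since the length of the linked list is
unknown until it has been traversed; `reaches_list_done` fills it in as a difference of addresses.
-/
theorem reaches_val_part_nil (h : Regs R a f fl S l s A) (hS : 0 < S) (ht : M S = 3)
    (hn : M (S + 2) = 0) :
    Reaches 40 ⟨124, R, M⟩ fun c => c.pc = 198 ∧ Regs c.reg a f fl S l s A ∧
      c.reg 15 = M (S + 4) ∧ c.reg 12 = f + 2 ∧ c.reg 18 = f + 3 ∧ c.reg 20 = M (S + 1) ∧
      c.mem = Function.update (Function.update M f 1) (f + 2) a := by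
  obtain ⟨h0, h1, h2, h3, h4, h5, h6, h7, h8, h9, h10⟩ := h
  iterate 19
    refine Reaches.next rfl ?_
    simp only [Instr.next, Function.update_apply, Nat.reduceAdd, Nat.reduceEqDiff, Nat.reduceSub,
      reduceIte, OfNat.ofNat_ne_zero, Nat.reduceLT, Nat.add_assoc, Nat.add_zero, Nat.lt_irrefl, *]
  exact Reaches.refl (by simp [Regs, Function.update_apply, *])

theorem reaches_list_done (h : Regs R a f fl S l s A) (hp : R 15 = 0) :
    Reaches 40 ⟨198, R, M⟩ fun c =>
      Ready c f (R 18) fl (R 20) l s A ∧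
      c.mem = Function.update M (f + 1) (R 18 - R 12) := by
  obtain ⟨h0, h1, h2, h3, h4, h5, h6, h7, h8, h9, h10⟩ := h
  iterate 8
    refine Reaches.next rfl ?_
    simp only [Instr.next, Function.update_apply, Nat.reduceAdd, Nat.reduceEqDiff, Nat.reduceSub,
      reduceIte, OfNat.ofNat_ne_zero, Nat.reduceLT, Nat.add_assoc, Nat.add_zero, Nat.lt_irrefl, *]
  exact Reaches.refl (by simp [Ready, Regs, Function.update_apply, *])

/-- The link to the next cell is read after the store, hence from the updated memory; `reaches_list`
shows that the store did not touch it. -/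
theorem reaches_list_succ (h : Regs R a f fl S l s A) (hp : 0 < R 15) :
    Reaches 30 ⟨198, R, M⟩ fun c => c.pc = 198 ∧ Regs c.reg a f fl S l s A ∧
      c.reg 15 = Function.update M (R 18) (M (R 15)) (R 15 + 1) ∧ c.reg 12 = R 12 ∧
      c.reg 18 = R 18 + 1 ∧ c.reg 20 = R 20 ∧ c.mem = Function.update M (R 18) (M (R 15)) := by
  obtain ⟨h0, h1, h2, h3, h4, h5, h6, h7, h8, h9, h10⟩ := h
  iterate 7
    refine Reaches.next rfl ?_
    simp only [Instr.next, Function.update_apply, Nat.reduceAdd, Nat.reduceEqDiff, Nat.reduceSub,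
      reduceIte, OfNat.ofNat_ne_zero, Nat.reduceLT, Nat.add_assoc, Nat.add_zero, Nat.lt_irrefl, *]
  exact Reaches.refl (by simp [Regs, Function.update_apply, *])

/-- The old entry is not modified: a list cell for the new value is written at `f`, then a fresh
entry at `f + 2` that shares the code array and the rest of the stack. This persistence makes
sharing safe. -/
theorem reaches_val_part_succ {n : ℕ} (h : Regs R a f fl S l s A) (hS : 0 < S) (ht : M S = 3)
    (hn : M (S + 2) = n + 1) :
    Reaches 80 ⟨124, R, M⟩ fun c =>
      Ready c (M (M (S + 3) + n)) (f + 7) 0 (f + 2) l s A ∧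
      c.mem = Function.update (Function.update (Function.update (Function.update
        (Function.update (Function.update (Function.update M f a) (f + 1) (M (S + 4)))
        (f + 2) 3) (f + 3) (M (S + 1))) (f + 4) n) (f + 5) (M (S + 3))) (f + 6) f := by
  obtain ⟨h0, h1, h2, h3, h4, h5, h6, h7, h8, h9, h10⟩ := h
  iterate 37
    refine Reaches.next rfl ?_
    simp only [Instr.next, Function.update_apply, Nat.reduceAdd, Nat.reduceEqDiff, Nat.reduceSub,
      reduceIte, OfNat.ofNat_ne_zero, Nat.reduceLT, Nat.add_assoc, Nat.add_zero, Nat.lt_irrefl,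
      Nat.zero_lt_succ, Nat.add_sub_cancel, *]
  exact Reaches.refl (by simp [Ready, Regs, Function.update_apply, *])

end Blocks

/-! ## Representations in growing memories -/

/-- `M'` agrees with `M` below `f`. -/
def Agree (f : ℕ) (M M' : ℕ → ℕ) : Prop := ∀ x < f, M' x = M x

theorem Agree.refl (f : ℕ) (M : ℕ → ℕ) : Agree f M M := fun _ _ => rfl

theorem Agree.update {f d v : ℕ} {M M' : ℕ → ℕ} (h : Agree f M M') (hd : f ≤ d) :
    Agree f M (Function.update M' d v) := fun x hx => by
  rw [Function.update_of_ne (by omega), h x hx]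

theorem Agree.trans {f d : ℕ} {M M' M'' : ℕ → ℕ} (h : Agree f M M') (h' : Agree d M' M'')
    (hd : f ≤ d) : Agree f M M'' := fun x hx => by
  rw [h' x (by omega), h x hx]

section Mono

variable {M M' : ℕ → ℕ} {f f' : ℕ}

/-- This lemma and the following ones rest on the same observation: a representation bounded by `f`
only reads cells below `f`, so it survives writes from `f` on and any increase of the bound. -/
theorem PVarAt.mono (hM : Agree f M M') (hf : f ≤ f') {a : ℕ} {p : PVar} (h : PVarAt M f a p) :
    PVarAt M' f' a p := by
  obtain ⟨h1, h2, h3⟩ := h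
  exact ⟨by omega, by rw [hM _ (by omega), h2], by rw [hM _ h1, h3]⟩

theorem CodeAt.mono (hM : Agree f M M') (hf : f ≤ f') {a : ℕ} {t : TTm} (h : CodeAt M f a t) :
    CodeAt M' f' a t := by
  induction h with
  | pvar a p h => exact .pvar a p (h.mono hM hf)
  | proj a i t h1 h2 h3 _ ih =>
    refine .proj a i t (by omega) ?_ ?_ ?_
    · rw [hM _ (by omega), h2]
    · rw [hM _ (by omega), h3]
    · rw [hM _ h1]; exact ih
  | tup a ts h1 h2 h3 _ ih =>
    refine .tup a ts (by omega) ?_ ?_ fun k hk => ?_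
    · rw [hM _ (by omega), h2]
    · rw [hM _ (by omega), h3]
    · rw [hM _ (by omega)]; exact ih k hk
  | app a t u h1 h2 _ _ ih1 ih2 =>
    refine .app a t u (by omega) ?_ ?_ ?_
    · rw [hM _ (by omega), h2]
    · rw [hM _ (by omega)]; exact ih1
    · rw [hM _ (by omega)]; exact ih2
  | clos a t b h1 h2 _ h4 h5 ih =>
    refine .clos a t b (by omega) ?_ ?_ ?_ fun k hk => ?_
    · rw [hM _ (by omega), h2]
    · rw [hM _ (by omega)]; exact ih
    · rw [hM _ (by omega), h4]
    · rw [hM _ (by omega)]; exact (h5 k hk).mono hM hf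

theorem ValAt.mono (hM : Agree f M M') (hf : f ≤ f') {a : ℕ} {v : Val} (h : ValAt M f a v) :
    ValAt M' f' a v := by
  induction h with
  | clos a t bag h1 h2 h3 _ ih =>
    refine .clos a t bag (by omega) ?_ ?_ ?_
    · rw [hM _ (by omega), h2]
    · rw [hM _ (by omega)]; exact h3.mono hM hf
    · rw [hM _ (by omega)]; exact ih
  | tup a vs h1 h2 h3 _ ih =>
    refine .tup a vs (by omega) ?_ ?_ fun k hk => ?_
    · rw [hM _ (by omega), h2]
    · rw [hM _ (by omega), h3]
    · rw [hM _ (by omega)]; exact ih k hk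

theorem ListAt.mono (hM : Agree f M M') (hf : f ≤ f') {a : ℕ} {vs : List Val}
    (h : ListAt M f a vs) : ListAt M' f' a vs := by
  induction vs generalizing a with
  | nil => exact h
  | cons v vs ih =>
    obtain ⟨h1, h2, h3, h4⟩ := h
    refine ⟨h1, by omega, ?_, ?_⟩
    · rw [hM _ (by omega)]; exact h3.mono hM hf
    · rw [hM _ h2]; exact ih h4

theorem EntryAt.mono (hM : Agree f M M') (hf : f ≤ f') {a : ℕ} {en : Entry}
    (h : EntryAt M f a en) : EntryAt M' f' a en := by
  cases en with
  | code t =>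
    obtain ⟨h1, h2, h3⟩ := h
    refine ⟨by omega, ?_, ?_⟩
    · rw [hM _ (by omega), h2]
    · rw [hM _ h1]; exact h3.mono hM hf
  | val v =>
    obtain ⟨h1, h2, h3⟩ := h
    refine ⟨by omega, ?_, ?_⟩
    · rw [hM _ (by omega), h2]
    · rw [hM _ h1]; exact h3.mono hM hf
  | proj i =>
    obtain ⟨h1, h2, h3⟩ := h
    exact ⟨by omega, by rw [hM _ (by omega), h2], by rw [hM _ h1, h3]⟩
  | part ts vs =>
    obtain ⟨h1, h2, h3, h4, h5⟩ := h
    refine ⟨by omega, ?_, ?_, fun k hk => ?_, ?_⟩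
    · rw [hM _ (by omega), h2]
    · rw [hM _ (by omega), h3]
    · obtain ⟨h6, h7⟩ := h4 k hk
      rw [hM (a + 3) (by omega), hM _ h6]
      exact ⟨by omega, h7.mono hM hf⟩
    · rw [hM _ h1]; exact h5.mono hM hf

theorem EntryAt.add_one_lt {a : ℕ} {en : Entry} (h : EntryAt M f a en) : a + 1 < f := by
  cases en <;> have := h.1 <;> omega

theorem StackAt.mono (hM : Agree f M M') (hf : f ≤ f') {a : ℕ} {S : List Entry}
    (h : StackAt M f a S) : StackAt M' f' a S := by
  induction S generalizing a with
  | nil => exact h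
  | cons en S ih =>
    obtain ⟨h1, h2, h3⟩ := h
    refine ⟨h1, h2.mono hM hf, ?_⟩
    rw [hM _ h2.add_one_lt]; exact ih h3

theorem EnvAt.mono (hM : Agree f M M') (hf : f ≤ f') {a b : ℕ} {E : Env}
    (h : EnvAt M f a b E) : EnvAt M' f' a b E :=
  ⟨h.1.mono hM hf, h.2.mono hM hf⟩

theorem ActsAt.mono (hM : Agree f M M') (hf : f ≤ f') {a : ℕ} {A : List (List Entry × Env)}
    (h : ActsAt M f a A) : ActsAt M' f' a A := by
  induction A generalizing a with
  | nil => exact h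
  | cons x A ih =>
    obtain ⟨S, E⟩ := x
    obtain ⟨h1, h2, h3, h4, h5⟩ := h
    refine ⟨h1, by omega, ?_, ?_, ?_⟩
    · rw [hM _ (by omega)]; exact h3.mono hM hf
    · rw [hM _ (by omega), hM _ (by omega)]; exact h4.mono hM hf
    · rw [hM _ (by omega)]; exact ih h5

theorem FocusAt.mono (hM : Agree f M M') (hf : f ≤ f') {fl a : ℕ} {x : Focus}
    (h : FocusAt M f fl a x) : FocusAt M' f' fl a x := by
  cases x with
  | code t => exact ⟨h.1, h.2.mono hM hf⟩
  | val v => exact ⟨h.1, h.2.mono hM hf⟩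

end Mono

/-! ## Look-up in represented tuples -/

theorem ValAt.length_eq {M : ℕ → ℕ} {f a : ℕ} {vs : List Val} (h : ValAt M f a (.tup vs)) :
    M (a + 1) = vs.length := by
  cases h; assumption

theorem ValAt.tag_tup {M : ℕ → ℕ} {f a : ℕ} {vs : List Val} (h : ValAt M f a (.tup vs)) :
    M a = 1 := by
  cases h; assumption

theorem ValAt.lt {M : ℕ → ℕ} {f a : ℕ} {v : Val} (h : ValAt M f a v) : a + 1 < f := by
  cases h <;> omega

/-- Component `i`, counted from 1, sits after two header cells, at `a + 2 + (i - 1)`; the form `a +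
(1 + i)` is the one in which the machine computes it. -/
theorem ValAt.component {M : ℕ → ℕ} {f a i : ℕ} {vs : List Val} {v : Val}
    (h : ValAt M f a (.tup vs)) (hv : component vs i = some v) :
    0 < i ∧ i - M (a + 1) = 0 ∧ a + (1 + i) < f ∧ ValAt M f (M (a + (1 + i))) v := by
  cases h with
  | tup _ _ h1 h2 h3 h4 =>
    unfold TTAM.component at hv
    split_ifs at hv with hi
    obtain ⟨hk, rfl⟩ := List.getElem?_eq_some_iff.1 hv
    have := h4 (i - 1) hk
    rw [show a + 2 + (i - 1) = a + (1 + i) by omega] at this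
    exact ⟨by omega, by omega, by omega, this⟩

theorem ValAt.component_none {M : ℕ → ℕ} {f a i : ℕ} {vs : List Val}
    (h : ValAt M f a (.tup vs)) (hv : TTAM.component vs i = none) :
    i = 0 ∨ 0 < i ∧ 0 < i - M (a + 1) := by
  rw [h.length_eq]
  unfold TTAM.component at hv
  split_ifs at hv with hi
  · exact .inl hi
  · rw [List.getElem?_eq_none_iff] at hv
    omega

/-- Treats both special variables at once, by exhibiting the tuple `T` that the machine consults in
the form that the block lemmas expect. -/
theorem EnvAt.lookup {M : ℕ → ℕ} {f l s q : ℕ} {E : Env} {p : PVar} (h : EnvAt M f l s E)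
    (hp : PVarAt M f q p) :
    ∃ T vs, (M q = 0 ∧ T = l ∨ M q = 1 ∧ T = s) ∧ ValAt M f T (.tup vs) ∧
      E.lookup p = TTAM.component vs (M (q + 1)) := by
  obtain ⟨v, i⟩ := p
  obtain ⟨h1, h2, h3⟩ := hp
  cases v with
  | l => exact ⟨l, E.l, .inl ⟨h2, rfl⟩, h.1, by rw [h3]; rfl⟩
  | s => exact ⟨s, E.s, .inr ⟨h2, rfl⟩, h.2, by rw [h3]; rfl⟩

/-! ## Loops -/

section Loops

variable {a f fl S l s A : ℕ} {E : Env}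

/-- The represented state lies below `f` and the writing position `d` moves above it. Agreement
below `d`, and not merely below `f`, is what protects the cells already written. -/
theorem reaches_bag {b : List PVar} {vs : List Val}
    (hv : List.Forall₂ (fun p v => E.lookup p = some v) b vs) {R M : ℕ → ℕ} {p d : ℕ}
    (h : Regs R a f fl S l s A) (h16 : R 16 = b.length) (h17 : R 17 = p) (h18 : R 18 = d)
    (hd : f ≤ d) (hb : ∀ (k : ℕ) (hk : k < b.length), p + k < f ∧ PVarAt M f (M (p + k)) b[k])
    (hE : EnvAt M f l s E) :
    Reaches (30 * b.length) ⟨91, R, M⟩ fun c => c.pc = 91 ∧ Regs c.reg a f fl S l s A ∧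
      c.reg 16 = 0 ∧ c.reg 18 = d + b.length ∧ Agree d M c.mem ∧
      ∀ (k : ℕ) (hk : k < vs.length), ValAt c.mem f (c.mem (d + k)) vs[k] := by
  induction hv generalizing R M p d with
  | nil =>
    exact Reaches.refl ⟨rfl, h, h16, h18, Agree.refl _ _,
      fun k hk => absurd hk (Nat.not_lt_zero k)⟩
  | @cons q v b vs hq hv ih =>
    obtain ⟨hp, h0⟩ := hb 0 (Nat.zero_lt_succ _)
    obtain ⟨T, ws, hT, hw, hl⟩ := hE.lookup h0
    simp only [List.getElem_cons_zero] at hl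
    obtain ⟨h1, h2, h3, h4⟩ := hw.component (hl.symm.trans hq)
    rw [List.length_cons, Nat.mul_succ, Nat.add_comm]
    refine (reaches_bag_succ h h16 h17 h18 rfl hT h1 h2).trans ?_
    rintro ⟨pc, R', M'⟩ ⟨rfl, hr, h16', h17', h18', hm⟩
    subst hm
    -- `hM` preserves the part of the tuple already written, `hM'` the represented data.
    have hM : Agree d M (Function.update M d (M (T + (1 + M (M (p + 0) + 1))))) :=
      (Agree.refl _ _).update le_rfl
    have hM' : Agree f M (Function.update M d (M (T + (1 + M (M (p + 0) + 1))))) :=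
      (Agree.refl _ _).update hd
    refine (ih hr h16' h17' h18' (by omega) (fun k hk => ?_) (hE.mono hM' le_rfl)).mono le_rfl ?_
    · obtain ⟨h5, h6⟩ := hb (k + 1) (Nat.succ_lt_succ hk)
      rw [show p + 1 + k = p + (k + 1) by omega, hM' _ h5]
      exact ⟨h5, h6.mono hM' le_rfl⟩
    · rintro c ⟨e1, e2, e3, e4, e5, e6⟩
      refine ⟨e1, e2, e3, by rw [e4]; omega, hM.trans e5 (by omega), fun k hk => ?_⟩
      cases k with
      | zero =>
        rw [Nat.add_zero, e5 _ (by omega), Function.update_self, List.getElem_cons_zero]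
        exact h4.mono (hM'.trans e5 (by omega)) le_rfl
      | succ k =>
        have := e6 k (Nat.lt_of_succ_lt_succ hk)
        rwa [show d + 1 + k = d + (k + 1) by omega] at this

/-- If a look-up fails midway, the partly written tuple is garbage at or above `f`. The registers of
the state are unchanged, so the halted configuration still represents the state before the attempt.
-/
theorem reaches_bag_stuck {b : List PVar}
    (hv : ¬ ∃ vs, List.Forall₂ (fun p v => E.lookup p = some v) b vs) {R M : ℕ → ℕ} {p d : ℕ}
    (h : Regs R a f fl S l s A) (h16 : R 16 = b.length) (h17 : R 17 = p) (h18 : R 18 = d)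
    (hd : f ≤ d) (hb : ∀ (k : ℕ) (hk : k < b.length), p + k < f ∧ PVarAt M f (M (p + k)) b[k])
    (hE : EnvAt M f l s E) :
    Reaches (30 * b.length) ⟨91, R, M⟩ fun c => Halted c a f fl S l s A ∧ Agree d M c.mem := by
  induction b generalizing R M p d with
  | nil => exact absurd ⟨[], .nil⟩ hv
  | cons q b ih =>
    obtain ⟨hp, h0⟩ := hb 0 (Nat.zero_lt_succ _)
    obtain ⟨T, ws, hT, hw, hl⟩ := hE.lookup h0
    simp only [List.getElem_cons_zero] at hl
    rw [List.length_cons, Nat.mul_succ, Nat.add_comm]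
    cases hq : E.lookup q with
    | none =>
      refine (reaches_bag_halt h h16 h17 rfl hT
        (hw.component_none (hl.symm.trans hq))).mono (by omega) ?_
      rintro c ⟨e1, e2⟩
      exact ⟨e1, e2 ▸ Agree.refl _ _⟩
    | some v =>
      obtain ⟨h1, h2, h3, h4⟩ := hw.component (hl.symm.trans hq)
      refine (reaches_bag_succ h h16 h17 h18 rfl hT h1 h2).trans ?_
      rintro ⟨pc, R', M'⟩ ⟨rfl, hr, h16', h17', h18', hm⟩
      subst hm
      have hM : Agree d M (Function.update M d (M (T + (1 + M (M (p + 0) + 1))))) :=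
        (Agree.refl _ _).update le_rfl
      have hM' : Agree f M (Function.update M d (M (T + (1 + M (M (p + 0) + 1))))) :=
        (Agree.refl _ _).update hd
      refine (ih ?_ hr h16' h17' h18' (by omega) (fun k hk => ?_)
        (hE.mono hM' le_rfl)).mono le_rfl ?_
      · rintro ⟨vs, hvs⟩
        exact hv ⟨v :: vs, .cons hq hvs⟩
      · obtain ⟨h5, h6⟩ := hb (k + 1) (Nat.succ_lt_succ hk)
        rw [show p + 1 + k = p + (k + 1) by omega, hM' _ h5]
        exact ⟨h5, h6.mono hM' le_rfl⟩
      · rintro c ⟨e1, e2⟩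
        exact ⟨e1, hM.trans e2 (by omega)⟩

theorem reaches_list {vs : List Val} {R M : ℕ → ℕ} {p d : ℕ}
    (h : Regs R a f fl S l s A) (h15 : R 15 = p) (h18 : R 18 = d)
    (hd : f ≤ d) (hvs : ListAt M f p vs) :
    Reaches (30 * vs.length) ⟨198, R, M⟩ fun c => c.pc = 198 ∧ Regs c.reg a f fl S l s A ∧
      c.reg 15 = 0 ∧ c.reg 12 = R 12 ∧ c.reg 18 = d + vs.length ∧ c.reg 20 = R 20 ∧
      Agree d M c.mem ∧
      ∀ (k : ℕ) (hk : k < vs.length), ValAt c.mem f (c.mem (d + k)) vs[k] := by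
  induction vs generalizing R M p d with
  | nil =>
    exact Reaches.refl ⟨rfl, h, h15.trans hvs, rfl, h18, rfl, Agree.refl _ _,
      fun k hk => absurd hk (Nat.not_lt_zero k)⟩
  | cons v vs ih =>
    obtain ⟨h1, h2, h3, h4⟩ := hvs
    refine ((reaches_list_succ h (by omega)).trans (L := 30 * vs.length) ?_).mono
      (by rw [List.length_cons]; omega) fun _ hc => hc
    rintro ⟨pc, R', M'⟩ ⟨rfl, hr, h15', h12', h18', h20', hm⟩
    simp only at hm hr h15' h12' h18' h20'
    rw [h18, h15] at hm h15'
    rw [← hm] at h15'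
    have hM : Agree d M M' := hm ▸ (Agree.refl _ _).update le_rfl
    have hM' : Agree f M M' := hm ▸ (Agree.refl _ _).update hd
    -- The link was read after the store at `d`; as `f ≤ d`, it is still the original one.
    rw [hM' _ h2] at h15'
    refine (ih hr h15' h18' (by omega) (h4.mono hM' le_rfl)).mono le_rfl ?_
    rintro c ⟨e1, e2, e3, e4, e5, e6, e7, e8⟩
    refine ⟨e1, e2, e3, e4.trans h12', by rw [e5, List.length_cons]; omega, e6.trans h20',
      hM.trans (h18 ▸ e7) (by omega), fun k hk => ?_⟩
    cases k with
    | zero =>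
      rw [Nat.add_zero, e7 _ (by omega), hm, Function.update_self, List.getElem_cons_zero]
      exact h3.mono (hM'.trans e7 (by omega)) le_rfl
    | succ k =>
      have := e8 k (Nat.lt_of_succ_lt_succ hk)
      rwa [h18, show d + 1 + k = d + (k + 1) by omega] at this

end Loops

/-! ## Simulation of the transitions -/

/-- The memory and the registers represent a state. -/
structure Rep (M : ℕ → ℕ) (a f fl S l s A : ℕ) (σ : State) : Prop where
  focus : FocusAt M f fl a σ.focus
  stack : StackAt M f S σ.stack
  env : EnvAt M f l s σ.env
  acts : ActsAt M f A σ.acts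

/-- At the start of the main loop, in a representation of `σ`. -/
def AtState (σ : State) (c : Config) : Prop :=
  ∃ a f fl S l s A, Ready c a f fl S l s A ∧ Rep c.mem a f fl S l s A σ

/-- Halted in a representation of `σ`. -/
def HaltedAt (σ : State) (c : Config) : Prop :=
  step machine c = none ∧ Represents c σ

theorem Rep.mono {M M' : ℕ → ℕ} {a f fl S l s A : ℕ} {σ : State} (h : Rep M a f fl S l s A σ)
    (hM : Agree f M M') : Rep M' a f fl S l s A σ :=
  ⟨h.focus.mono hM le_rfl, h.stack.mono hM le_rfl, h.env.mono hM le_rfl, h.acts.mono hM le_rfl⟩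

theorem Rep.represents {c : Config} {a f fl S l s A : ℕ} {σ : State}
    (hr : Regs c.reg a f fl S l s A) (h : Rep c.mem a f fl S l s A σ) : Represents c σ := by
  obtain ⟨rfl, rfl, rfl, rfl, rfl, rfl, rfl, -⟩ := hr
  exact ⟨h.focus, h.stack, h.env, h.acts⟩

theorem AtState.represents {c : Config} {σ : State} (h : AtState σ c) : Represents c σ := by
  obtain ⟨a, f, fl, S, l, s, A, h1, h2⟩ := h
  exact h2.represents h1.2

theorem Halted.haltedAt {M : ℕ → ℕ} {c : Config} {a f fl S l s A : ℕ} {σ : State}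
    (hr : Halted c a f fl S l s A) (h : Rep M a f fl S l s A σ) (hM : Agree f M c.mem) :
    HaltedAt σ c :=
  ⟨hr.1, (h.mono hM).represents hr.2⟩

section Simulation

variable {R M : ℕ → ℕ} {a f fl S l s A : ℕ} {st : List Entry} {E : Env}
  {acts : List (List Entry × Env)}

theorem sim_app {t u : TTm} (h : Regs R a f fl S l s A)
    (hr : Rep M a f fl S l s A ⟨.code (.app t u), st, E, acts⟩) :
    Reaches 40 ⟨14, R, M⟩ (AtState ⟨.code u, .code t :: st, E, acts⟩) := by
  obtain ⟨⟨hfl, hc⟩, hS, hE, hA⟩ := hr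
  cases hc with
  | app _ _ _ h1 h2 h3 h4 =>
    refine (reaches_app h h2).mono le_rfl ?_
    rintro c ⟨hc, hm⟩
    have hM : Agree f M c.mem := hm ▸
      (((Agree.refl f M).update le_rfl).update (by omega)).update (by omega)
    have m0 : c.mem f = 0 := by simp [hm]
    have m1 : c.mem (f + 1) = S := by simp [hm]
    have m2 : c.mem (f + 2) = M (a + 1) := by simp [hm]
    -- The address `f` of the new entry is not 0, the null pointer, because the code in focus lies
    -- below `f`.
    exact ⟨_, _, _, _, _, _, _, hc, ⟨hfl, h4.mono hM (by omega)⟩,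
      ⟨by omega, ⟨by omega, m0, m2 ▸ h3.mono hM (by omega)⟩, m1 ▸ hS.mono hM (by omega)⟩,
      hE.mono hM (by omega), hA.mono hM (by omega)⟩

theorem sim_proj {i : ℕ} {t : TTm} (h : Regs R a f fl S l s A)
    (hr : Rep M a f fl S l s A ⟨.code (.proj i t), st, E, acts⟩) :
    Reaches 40 ⟨14, R, M⟩ (AtState ⟨.code t, .proj i :: st, E, acts⟩) := by
  obtain ⟨⟨hfl, hc⟩, hS, hE, hA⟩ := hr
  cases hc with
  | proj _ _ _ h1 h2 h3 h4 =>
    refine (reaches_proj h h2).mono le_rfl ?_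
    rintro c ⟨hc, hm⟩
    have hM : Agree f M c.mem := hm ▸
      (((Agree.refl f M).update le_rfl).update (by omega)).update (by omega)
    have m0 : c.mem f = 2 := by simp [hm]
    have m1 : c.mem (f + 1) = S := by simp [hm]
    have m2 : c.mem (f + 2) = i := by simp [hm, h3]
    exact ⟨_, _, _, _, _, _, _, hc, ⟨hfl, h4.mono hM (by omega)⟩,
      ⟨by omega, ⟨by omega, m0, m2⟩, m1 ▸ hS.mono hM (by omega)⟩,
      hE.mono hM (by omega), hA.mono hM (by omega)⟩

theorem sim_tup_nil (h : Regs R a f fl S l s A)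
    (hr : Rep M a f fl S l s A ⟨.code (.tup []), st, E, acts⟩) :
    Reaches 40 ⟨14, R, M⟩ (AtState ⟨.val (.tup []), st, E, acts⟩) := by
  obtain ⟨⟨hfl, hc⟩, hS, hE, hA⟩ := hr
  cases hc with
  | tup _ _ h1 h2 h3 h4 =>
    refine (reaches_tup_nil h h2 h3).mono le_rfl ?_
    rintro c ⟨hc, hm⟩
    have hM : Agree f M c.mem := hm ▸ ((Agree.refl f M).update le_rfl).update (by omega)
    have m0 : c.mem f = 1 := by simp [hm]
    have m1 : c.mem (f + 1) = 0 := by simp [hm]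
    exact ⟨_, _, _, _, _, _, _, hc,
      ⟨rfl, .tup _ _ (by simp) m0 m1 fun k hk => absurd hk (Nat.not_lt_zero k)⟩,
      hS.mono hM (by omega), hE.mono hM (by omega), hA.mono hM (by omega)⟩

theorem sim_tup_append {ts : List TTm} {t : TTm} (h : Regs R a f fl S l s A)
    (hr : Rep M a f fl S l s A ⟨.code (.tup (ts ++ [t])), st, E, acts⟩) :
    Reaches 60 ⟨14, R, M⟩ (AtState ⟨.code t, .part ts [] :: st, E, acts⟩) := by
  obtain ⟨⟨hfl, hc⟩, hS, hE, hA⟩ := hr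
  cases hc with
  | tup _ _ h1 h2 h3 h4 =>
    rw [List.length_append, List.length_singleton] at h1 h3
    refine (reaches_tup_succ h h2 h3).mono le_rfl ?_
    rintro c ⟨hc, hm⟩
    have hM : Agree f M c.mem := hm ▸
      (((((Agree.refl f M).update le_rfl).update (by omega)).update (by omega)).update
        (by omega)).update (by omega)
    have m0 : c.mem f = 3 := by simp [hm]
    have m1 : c.mem (f + 1) = S := by simp [hm]
    have m2 : c.mem (f + 2) = ts.length := by simp [hm]
    have m3 : c.mem (f + 3) = a + 2 := by simp [hm]
    have m4 : c.mem (f + 4) = 0 := by simp [hm]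
    have ht := h4 ts.length (by simp)
    rw [List.getElem_append_right le_rfl] at ht
    simp only [Nat.sub_self, List.getElem_cons_zero] at ht
    rw [show a + 2 + ts.length = a + (ts.length + 2) by omega] at ht
    refine ⟨_, _, _, _, _, _, _, hc, ⟨hfl, ht.mono hM (by omega)⟩,
      ⟨by omega, ⟨by omega, m0, m2, fun k hk => ?_, m4⟩, m1 ▸ hS.mono hM (by omega)⟩,
      hE.mono hM (by omega), hA.mono hM (by omega)⟩
    have := h4 k (by simp; omega)
    rw [List.getElem_append_left hk] at this
    rw [m3, hM _ (by omega)]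
    exact ⟨by omega, this.mono hM (by omega)⟩

theorem sim_pvar {p : PVar} {v : Val} (hv : E.lookup p = some v) (h : Regs R a f fl S l s A)
    (hr : Rep M a f fl S l s A ⟨.code (.pvar p), st, E, acts⟩) :
    Reaches 40 ⟨14, R, M⟩ (AtState ⟨.val v, st, E, acts⟩) := by
  obtain ⟨⟨hfl, hc⟩, hS, hE, hA⟩ := hr
  cases hc with
  | pvar _ _ hp =>
    obtain ⟨T, ws, hT, hw, hl⟩ := hE.lookup hp
    obtain ⟨h1, h2, h3, h4⟩ := hw.component (hl.symm.trans hv)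
    refine (reaches_var h hT h1 h2).mono le_rfl ?_
    rintro c ⟨hc, rfl⟩
    exact ⟨_, _, _, _, _, _, _, hc, ⟨rfl, h4⟩, hS, hE, hA⟩

theorem sim_pvar_stuck {p : PVar} (hv : E.lookup p = none) (h : Regs R a f fl S l s A)
    (hr : Rep M a f fl S l s A ⟨.code (.pvar p), st, E, acts⟩) :
    Reaches 40 ⟨14, R, M⟩ (HaltedAt ⟨.code (.pvar p), st, E, acts⟩) := by
  have hr' := hr
  obtain ⟨⟨hfl, hc⟩, hS, hE, hA⟩ := hr
  cases hc with
  | pvar _ _ hp =>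
    obtain ⟨T, ws, hT, hw, hl⟩ := hE.lookup hp
    refine (reaches_var_halt h hT (hw.component_none (hl.symm.trans hv))).mono le_rfl ?_
    rintro c ⟨hc, rfl⟩
    exact hc.haltedAt hr' (Agree.refl _ _)

theorem sim_clos {t : TTm} {b : List PVar} {vs : List Val}
    (hv : List.Forall₂ (fun p v => E.lookup p = some v) b vs) (h : Regs R a f fl S l s A)
    (hr : Rep M a f fl S l s A ⟨.code (.clos t b), st, E, acts⟩) :
    Reaches (40 + 30 * b.length + 40) ⟨14, R, M⟩ (AtState ⟨.val (.clos t vs), st, E, acts⟩) := by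
  obtain ⟨⟨hfl, hc⟩, hS, hE, hA⟩ := hr
  cases hc with
  | clos _ _ _ h1 h2 h3 h4 h5 =>
    refine Reaches.trans ((reaches_clos h h2).trans (L := 30 * b.length)
      (Q' := fun c => c.pc = 91 ∧ Regs c.reg a f fl S l s A ∧ c.reg 16 = 0 ∧
        c.reg 18 = f + 2 + b.length ∧ Agree f M c.mem ∧ c.mem f = 1 ∧
        c.mem (f + 1) = b.length ∧
        ∀ (k : ℕ) (hk : k < vs.length), ValAt c.mem f (c.mem (f + 2 + k)) vs[k]) ?_) ?_
    · rintro ⟨pc, R', M'⟩ ⟨rfl, hr, h16, h17, h18, hm⟩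
      simp only at hm
      have hM : Agree f M M' := hm ▸ ((Agree.refl f M).update le_rfl).update (by omega)
      have m0 : M' f = 1 := by simp [hm]
      have m1 : M' (f + 1) = b.length := by simp [hm, h4]
      refine (reaches_bag hv hr (h16.trans h4) h17 h18 (by omega) (fun k hk => ?_)
        (hE.mono hM le_rfl)).mono le_rfl ?_
      · rw [hM _ (by omega)]
        exact ⟨by omega, (h5 k hk).mono hM le_rfl⟩
      · rintro c ⟨e1, e2, e3, e4, e5, e6⟩
        -- The header cells `f` and `f + 1` survive the loop, since it writes from `f + 2` on.
        exact ⟨e1, e2, e3, e4, hM.trans e5 (by omega), by rw [e5 _ (by omega), m0],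
          by rw [e5 _ (by omega), m1], e6⟩
    · rintro ⟨pc, R', M'⟩ ⟨rfl, e2, e3, e4, e5, e6, e7, e8⟩
      simp only at e2 e3 e4 e5 e6 e7 e8
      refine (reaches_bag_done e2 e3).mono le_rfl ?_
      rintro c ⟨hc, hm⟩
      rw [e4] at hc hm
      have hM' : Agree (f + 2 + b.length) M' c.mem := hm ▸
        (((Agree.refl _ M').update le_rfl).update (by omega)).update (by omega)
      have hM : Agree f M c.mem := e5.trans hM' (by omega)
      have m0 : c.mem (f + 2 + b.length) = 0 := by simp [hm]
      have m1 : c.mem (f + 2 + b.length + 1) = M (a + 1) := by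
        simp [hm, e5 (a + 1) (by omega)]
      have m2 : c.mem (f + 2 + b.length + 2) = f := by simp [hm]
      have hlen := hv.length_eq
      refine ⟨_, _, _, _, _, _, _, hc, ⟨rfl, .clos _ _ _ (by omega) m0
        (m1 ▸ h3.mono hM (by omega)) ?_⟩,
        hS.mono hM (by omega), hE.mono hM (by omega), hA.mono hM (by omega)⟩
      rw [m2]
      -- The bag is the tuple at `f`, finished by the loop; the closure record comes right after it.
      refine .tup _ _ (by omega) (by rw [hM' _ (by omega), e6])
        (by rw [hM' _ (by omega), e7, hlen]) fun k hk => ?_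
      rw [hM' _ (by omega)]
      exact (e8 k hk).mono (fun x hx => hM' x (by omega)) (by omega)

theorem sim_clos_stuck {t : TTm} {b : List PVar}
    (hv : ¬ ∃ vs, List.Forall₂ (fun p v => E.lookup p = some v) b vs)
    (h : Regs R a f fl S l s A)
    (hr : Rep M a f fl S l s A ⟨.code (.clos t b), st, E, acts⟩) :
    Reaches (40 + 30 * b.length) ⟨14, R, M⟩ (HaltedAt ⟨.code (.clos t b), st, E, acts⟩) := by
  have hr' := hr
  obtain ⟨⟨hfl, hc⟩, hS, hE, hA⟩ := hr
  cases hc with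
  | clos _ _ _ h1 h2 h3 h4 h5 =>
    refine (reaches_clos h h2).trans ?_
    rintro ⟨pc, R', M'⟩ ⟨rfl, hr, h16, h17, h18, hm⟩
    simp only at hm
    have hM : Agree f M M' := hm ▸ ((Agree.refl f M).update le_rfl).update (by omega)
    refine (reaches_bag_stuck hv hr (h16.trans h4) h17 h18 (by omega) (fun k hk => ?_)
      (hE.mono hM le_rfl)).mono le_rfl ?_
    · rw [hM _ (by omega)]
      exact ⟨by omega, (h5 k hk).mono hM le_rfl⟩
    · rintro c ⟨e1, e2⟩
      exact e1.haltedAt hr' (hM.trans e2 (by omega))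

theorem sim_val_stuck {v : Val} (h : Regs R a f fl S l s A)
    (hr : Rep M a f fl S l s A ⟨.val v, [], E, []⟩) :
    Reaches 40 ⟨124, R, M⟩ (HaltedAt ⟨.val v, [], E, []⟩) := by
  refine (reaches_val_nil_halt h hr.stack hr.acts).mono le_rfl ?_
  rintro c ⟨hc, rfl⟩
  exact hc.haltedAt hr (Agree.refl _ _)

theorem sim_val_pop {v : Val} {E' : Env} (h : Regs R a f fl S l s A)
    (hr : Rep M a f fl S l s A ⟨.val v, [], E, (st, E') :: acts⟩) :
    Reaches 40 ⟨124, R, M⟩ (AtState ⟨.val v, st, E', acts⟩) := by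
  obtain ⟨hc, hS, hE, h1, h2, h3, h4, h5⟩ := hr
  refine (reaches_val_pop h hS (by omega)).mono le_rfl ?_
  rintro c ⟨hc', rfl⟩
  exact ⟨_, _, _, _, _, _, _, hc', hc, h3, h4, h5⟩

theorem sim_val_code {v : Val} {t : TTm} (h : Regs R a f fl S l s A)
    (hr : Rep M a f fl S l s A ⟨.val v, .code t :: st, E, acts⟩) :
    Reaches 40 ⟨124, R, M⟩ (AtState ⟨.code t, .val v :: st, E, acts⟩) := by
  obtain ⟨⟨hfl, hc⟩, ⟨h1, ⟨h2, h3, h4⟩, hS⟩, hE, hA⟩ := hr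
  refine (reaches_val_code h (by omega) h3).mono le_rfl ?_
  rintro c ⟨hc', hm⟩
  have hM : Agree f M c.mem := hm ▸
    (((Agree.refl f M).update le_rfl).update (by omega)).update (by omega)
  have m0 : c.mem f = 1 := by simp [hm]
  have m1 : c.mem (f + 1) = M (S + 1) := by simp [hm]
  have m2 : c.mem (f + 2) = a := by simp [hm]
  exact ⟨_, _, _, _, _, _, _, hc', ⟨rfl, h4.mono hM (by omega)⟩,
    ⟨by omega, ⟨by omega, m0, m2 ▸ hc.mono hM (by omega)⟩, m1 ▸ hS.mono hM (by omega)⟩,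
    hE.mono hM (by omega), hA.mono hM (by omega)⟩

theorem sim_val_beta {t : TTm} {vs ws : List Val} (h : Regs R a f fl S l s A)
    (hr : Rep M a f fl S l s A ⟨.val (.clos t vs), .val (.tup ws) :: st, E, acts⟩) :
    Reaches 60 ⟨124, R, M⟩ (AtState ⟨.code t, [], ⟨vs, ws⟩, (st, E) :: acts⟩) := by
  obtain ⟨⟨hfl, hc⟩, ⟨h1, ⟨h2, h3, h4⟩, hS⟩, hE, hA⟩ := hr
  cases hc with
  | clos _ _ _ h5 h6 h7 h8 =>
    refine (reaches_val_beta h (by omega) h3 h6 h4.tag_tup).mono le_rfl ?_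
    rintro c ⟨hc', hm⟩
    have hM : Agree f M c.mem := hm ▸ ((((Agree.refl f M).update le_rfl).update
      (by omega)).update (by omega)).update (by omega)
    have m0 : c.mem f = A := by simp [hm]
    have m1 : c.mem (f + 1) = M (S + 1) := by simp [hm]
    have m2 : c.mem (f + 2) = l := by simp [hm]
    have m3 : c.mem (f + 3) = s := by simp [hm]
    exact ⟨_, _, _, _, _, _, _, hc', ⟨rfl, h7.mono hM (by omega)⟩, rfl,
      ⟨h8.mono hM (by omega), h4.mono hM (by omega)⟩, by omega, by omega,
      m1 ▸ hS.mono hM (by omega), m2 ▸ m3 ▸ hE.mono hM (by omega), m0 ▸ hA.mono hM (by omega)⟩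

theorem ValAt.tag_clos {t : TTm} {vs : List Val} (h : ValAt M f a (.clos t vs)) : M a = 0 := by
  cases h; assumption

theorem sim_val_val_stuck {v w : Val} (hvw : (∃ vs, v = .tup vs) ∨ ∃ t vs, w = .clos t vs)
    (h : Regs R a f fl S l s A)
    (hr : Rep M a f fl S l s A ⟨.val v, .val w :: st, E, acts⟩) :
    Reaches 40 ⟨124, R, M⟩ (HaltedAt ⟨.val v, .val w :: st, E, acts⟩) := by
  have hr' := hr
  obtain ⟨⟨hfl, hc⟩, ⟨h1, ⟨h2, h3, h4⟩, hS⟩, hE, hA⟩ := hr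
  refine (reaches_val_beta_halt h (by omega) h3 ?_).mono le_rfl ?_
  · obtain ⟨vs, rfl⟩ | ⟨t, vs, rfl⟩ := hvw
    · exact .inl (by rw [hc.tag_tup]; omega)
    · cases v with
      | clos t' vs' => exact .inr ⟨hc.tag_clos, h4.tag_clos⟩
      | tup vs' => exact .inl (by rw [hc.tag_tup]; omega)
  · rintro c ⟨hh, rfl⟩
    exact hh.haltedAt hr' (Agree.refl _ _)

theorem sim_val_pi {vs : List Val} {i : ℕ} {v : Val} (hv : component vs i = some v)
    (h : Regs R a f fl S l s A)
    (hr : Rep M a f fl S l s A ⟨.val (.tup vs), .proj i :: st, E, acts⟩) :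
    Reaches 40 ⟨124, R, M⟩ (AtState ⟨.val v, st, E, acts⟩) := by
  obtain ⟨⟨hfl, hc⟩, ⟨h1, ⟨h2, h3, rfl⟩, hS⟩, hE, hA⟩ := hr
  obtain ⟨h5, h6, h7, h8⟩ := hc.component hv
  refine (reaches_val_pi h (by omega) h3 (by rw [hc.tag_tup]; omega) h5 h6).mono le_rfl ?_
  rintro c ⟨hc', rfl⟩
  exact ⟨_, _, _, _, _, _, _, hc', ⟨hfl, h8⟩, hS, hE, hA⟩

theorem sim_val_pi_stuck {v : Val} {i : ℕ}
    (hv : (∃ t vs, v = .clos t vs) ∨ ∃ vs, v = .tup vs ∧ component vs i = none)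
    (h : Regs R a f fl S l s A)
    (hr : Rep M a f fl S l s A ⟨.val v, .proj i :: st, E, acts⟩) :
    Reaches 40 ⟨124, R, M⟩ (HaltedAt ⟨.val v, .proj i :: st, E, acts⟩) := by
  have hr' := hr
  obtain ⟨⟨hfl, hc⟩, ⟨h1, ⟨h2, h3, rfl⟩, hS⟩, hE, hA⟩ := hr
  refine (reaches_val_pi_halt h (by omega) h3 ?_).mono le_rfl ?_
  · obtain ⟨t, vs, rfl⟩ | ⟨vs, rfl, hv⟩ := hv
    · exact .inl hc.tag_clos
    · exact .inr ⟨by rw [hc.tag_tup]; omega, hc.component_none hv⟩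
  · rintro c ⟨hh, rfl⟩
    exact hh.haltedAt hr' (Agree.refl _ _)

theorem sim_val_part_append {v : Val} {ts : List TTm} {t : TTm} {vs : List Val}
    (h : Regs R a f fl S l s A)
    (hr : Rep M a f fl S l s A ⟨.val v, .part (ts ++ [t]) vs :: st, E, acts⟩) :
    Reaches 80 ⟨124, R, M⟩ (AtState ⟨.code t, .part ts (v :: vs) :: st, E, acts⟩) := by
  obtain ⟨⟨hfl, hc⟩, ⟨h1, ⟨h2, h3, h4, h5, h6⟩, hS⟩, hE, hA⟩ := hr
  rw [List.length_append, List.length_singleton] at h4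
  refine (reaches_val_part_succ h (by omega) h3 h4).mono le_rfl ?_
  rintro c ⟨hc', hm⟩
  have hM : Agree f M c.mem := hm ▸ (((((((Agree.refl f M).update le_rfl).update
    (by omega)).update (by omega)).update (by omega)).update (by omega)).update
    (by omega)).update (by omega)
  have m0 : c.mem f = a := by simp [hm]
  have m1 : c.mem (f + 1) = M (S + 4) := by simp [hm]
  have m2 : c.mem (f + 2) = 3 := by simp [hm]
  have m3 : c.mem (f + 3) = M (S + 1) := by simp [hm]
  have m4 : c.mem (f + 4) = ts.length := by simp [hm]
  have m5 : c.mem (f + 5) = M (S + 3) := by simp [hm]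
  have m6 : c.mem (f + 6) = f := by simp [hm]
  obtain ⟨-, ht⟩ := h5 ts.length (by simp)
  rw [List.getElem_append_right le_rfl] at ht
  simp only [Nat.sub_self, List.getElem_cons_zero] at ht
  refine ⟨_, _, _, _, _, _, _, hc', ⟨rfl, ht.mono hM (by omega)⟩,
    ⟨by omega, ⟨by omega, m2, m4, fun k hk => ?_, ?_⟩, m3 ▸ hS.mono hM (by omega)⟩,
    hE.mono hM (by omega), hA.mono hM (by omega)⟩
  · obtain ⟨h7, h8⟩ := h5 k (by simp; omega)
    rw [List.getElem_append_left hk] at h8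
    rw [show f + 2 + 3 = f + 5 by omega, m5, hM _ h7]
    exact ⟨by omega, h8.mono hM (by omega)⟩
  · rw [show f + 2 + 4 = f + 6 by omega, m6]
    have := hc.lt
    exact ⟨by omega, by omega, m0 ▸ hc.mono hM (by omega), m1 ▸ h6.mono hM (by omega)⟩

theorem sim_val_part_nil {v : Val} {vs : List Val} (h : Regs R a f fl S l s A)
    (hr : Rep M a f fl S l s A ⟨.val v, .part [] vs :: st, E, acts⟩) :
    Reaches (40 + 30 * vs.length + 40) ⟨124, R, M⟩
      (AtState ⟨.val (.tup (v :: vs)), st, E, acts⟩) := by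
  obtain ⟨⟨hfl, hc⟩, ⟨h1, ⟨h2, h3, h4, h5, h6⟩, hS⟩, hE, hA⟩ := hr
  refine Reaches.trans ((reaches_val_part_nil h (by omega) h3 h4).trans (L := 30 * vs.length)
    (Q' := fun c => c.pc = 198 ∧ Regs c.reg a f fl S l s A ∧ c.reg 15 = 0 ∧
      c.reg 12 = f + 2 ∧ c.reg 18 = f + 3 + vs.length ∧ c.reg 20 = M (S + 1) ∧
      Agree f M c.mem ∧ c.mem f = 1 ∧ c.mem (f + 2) = a ∧
      ∀ (k : ℕ) (hk : k < vs.length), ValAt c.mem f (c.mem (f + 3 + k)) vs[k]) ?_) ?_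
  · rintro ⟨pc, R', M'⟩ ⟨rfl, hr, h15, h12, h18, h20, hm⟩
    simp only at hm h12 h20
    have hM : Agree f M M' := hm ▸ ((Agree.refl f M).update le_rfl).update (by omega)
    have m0 : M' f = 1 := by simp [hm]
    have m2 : M' (f + 2) = a := by simp [hm]
    refine (reaches_list hr h15 h18 (by omega) (h6.mono hM le_rfl)).mono le_rfl ?_
    rintro c ⟨e1, e2, e3, e4, e5, e6, e7, e8⟩
    exact ⟨e1, e2, e3, e4.trans h12, e5, e6.trans h20, hM.trans e7 (by omega),
      by rw [e7 _ (by omega), m0], by rw [e7 _ (by omega), m2], e8⟩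
  · rintro ⟨pc, R', M'⟩ ⟨rfl, e2, e3, e4, e5, e6, e7, e8, e9, e10⟩
    simp only at e2 e3 e4 e5 e6 e7 e8 e9 e10
    refine (reaches_list_done e2 e3).mono le_rfl ?_
    rintro c ⟨hc', hm⟩
    rw [e4, e5] at hm
    rw [e5, e6] at hc'
    have hM' : Agree f M' c.mem := hm ▸ (Agree.refl _ M').update (by omega)
    have hM : Agree f M c.mem := e7.trans hM' le_rfl
    have m0 : c.mem f = 1 := by simp [hm, e8]
    have m1 : c.mem (f + 1) = vs.length + 1 := by simp [hm]; omega
    refine ⟨_, _, _, _, _, _, _, hc', ⟨hfl, .tup _ _ (by simp; omega) m0 m1 fun k hk => ?_⟩,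
      hS.mono hM (by omega), hE.mono hM (by omega), hA.mono hM (by omega)⟩
    have m2 : c.mem (f + 2 + k) = M' (f + 2 + k) := by
      rw [hm, Function.update_of_ne (by omega)]
    rw [m2]
    -- The first component is the value that was in focus, at `f + 2`; the others were copied from
    -- the list, from `f + 3` on.
    cases k with
    | zero => exact e9.symm ▸ hc.mono hM (by omega)
    | succ k =>
      have := (e10 k (Nat.lt_of_succ_lt_succ hk)).mono hM' (show f ≤ f + 3 + vs.length by omega)
      rwa [show f + 3 + k = f + 2 + (k + 1) by omega] at this

end Simulation

/-! ## Cost of the transitions -/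

/-- The number of loop iterations, plus one, that the machine spends on a state. -/
def stateCost : State → ℕ
  | ⟨.code (.clos _ b), _, _, _⟩ => b.length + 1
  | ⟨.val _, .part [] vs :: _, _, _⟩ => vs.length + 1
  | _ => 1

theorem stateCost_pos (σ : State) : 1 ≤ stateCost σ := by
  unfold stateCost
  split <;> omega

/-- Accounts for the jump on the flag of the focus. This instruction is always executed, so the
number of steps is positive and the times of successive states strictly increase. -/
theorem Ready.dispatch {c : Config} {a f fl S l s A K : ℕ} {Q : Config → Prop}
    (hc : Ready c a f fl S l s A)
    (h : Reaches K ⟨if 0 < fl then 124 else 14, c.reg, c.mem⟩ Q) :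
    ∃ n, 0 < n ∧ n ≤ K + 1 ∧ ∃ c', exec machine n c = some c' ∧ Q c' := by
  obtain ⟨n, hn, c', he, hQ⟩ := h
  refine ⟨n + 1, by omega, by omega, c', ?_, hQ⟩
  obtain ⟨pc, R, M⟩ := c
  obtain ⟨rfl, -, -, rfl, -⟩ := hc
  exact he

theorem AtState.step {c : Config} {σ σ' : State} {α : Label} (hs : Step σ α σ')
    (h : AtState σ c) :
    ∃ n, 0 < n ∧ n ≤ 101 * stateCost σ ∧ ∃ c', exec machine n c = some c' ∧ AtState σ' c' := by
  obtain ⟨a, f, fl, S, l, s, A, hc, hr⟩ := h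
  have key : Reaches (100 * stateCost σ) ⟨if 0 < fl then 124 else 14, c.reg, c.mem⟩
      (AtState σ') := by
    have hr' := hc.2
    cases hs with
    | nsea1 t u S E A =>
      rw [hr.focus.1]
      exact (sim_app hr' hr).mono (by simp [stateCost]) fun _ => id
    | nsea2 i t S E A =>
      rw [hr.focus.1]
      exact (sim_proj hr' hr).mono (by simp [stateCost]) fun _ => id
    | nsea3 ts t S E A =>
      rw [hr.focus.1]
      exact (sim_tup_append hr' hr).mono (by simp [stateCost]) fun _ => id
    | nsea4 S E A =>
      rw [hr.focus.1]
      exact (sim_tup_nil hr' hr).mono (by simp [stateCost]) fun _ => id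
    | subw t b vs S A E h =>
      rw [hr.focus.1]
      exact (sim_clos h hr' hr).mono (by simp only [stateCost]; omega) fun _ => id
    | subv p v S A E h =>
      rw [hr.focus.1]
      exact (sim_pvar h hr' hr).mono (by simp [stateCost]) fun _ => id
    | esea1 v t S E A =>
      rw [hr.focus.1]
      exact (sim_val_code hr' hr).mono (by simp [stateCost]) fun _ => id
    | esea6 v ts t vs S E A =>
      rw [hr.focus.1]
      have := stateCost_pos ⟨.val v, .part (ts ++ [t]) vs :: S, E, A⟩
      exact (sim_val_part_append hr' hr).mono (by omega) fun _ => id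
    | esea3 v vs S E A =>
      rw [hr.focus.1]
      exact (sim_val_part_nil hr' hr).mono (by simp only [stateCost]; omega) fun _ => id
    | pi vs i v S E A h =>
      rw [hr.focus.1]
      exact (sim_val_pi h hr' hr).mono (by simp [stateCost]) fun _ => id
    | beta t vs ws S E A =>
      rw [hr.focus.1]
      exact (sim_val_beta hr' hr).mono (by simp [stateCost]) fun _ => id
    | esea7 v S E E' A =>
      rw [hr.focus.1]
      exact (sim_val_pop hr' hr).mono (by simp [stateCost]) fun _ => id
  have := stateCost_pos σ
  obtain ⟨n, h1, h2, h3⟩ := hc.dispatch key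
  exact ⟨n, h1, by omega, h3⟩

theorem AtState.halts {c : Config} {σ : State} (hσ : σ.Final) (h : AtState σ c) :
    ∃ n, n ≤ 101 * stateCost σ ∧ ∃ c', exec machine n c = some c' ∧ HaltedAt σ c' := by
  obtain ⟨a, f, fl, S, l, s, A, hc, hr⟩ := h
  have key : Reaches (100 * stateCost σ) ⟨if 0 < fl then 124 else 14, c.reg, c.mem⟩
      (HaltedAt σ) := by
    have hr' := hc.2
    have hpos := stateCost_pos σ
    -- Closes all cases in which a transition applies, by contradiction with finality. What remains
    -- are failed look-ups, values with both stacks empty, and applications or projections whose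
    -- operands have the wrong shape or range.
    have moves : ∀ a s', Step σ a s' → Reaches (100 * stateCost σ)
        ⟨if 0 < fl then 124 else 14, c.reg, c.mem⟩ (HaltedAt σ) :=
      fun a s' h => absurd h (hσ a s')
    obtain ⟨x, st, E, acts⟩ := σ
    cases x with
    | code t =>
      cases t with
      | pvar p =>
        cases hv : E.lookup p with
        | none =>
          rw [hr.focus.1]
          exact (sim_pvar_stuck hv hr' hr).mono (by omega) fun _ => id
        | some v => exact moves _ _ (.subv _ _ _ _ _ hv)
      | proj i t => exact moves _ _ (.nsea2 _ _ _ _ _)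
      | tup ts =>
        rcases List.eq_nil_or_concat ts with rfl | ⟨ts, t, rfl⟩
        · exact moves _ _ (.nsea4 _ _ _)
        · rw [List.concat_eq_append] at moves ⊢
          exact moves _ _ (.nsea3 _ _ _ _ _)
      | app t u => exact moves _ _ (.nsea1 _ _ _ _ _)
      | clos t b =>
        by_cases hv : ∃ vs, List.Forall₂ (fun p v => E.lookup p = some v) b vs
        · obtain ⟨vs, hv⟩ := hv
          exact moves _ _ (.subw _ _ _ _ _ _ hv)
        · rw [hr.focus.1]
          exact (sim_clos_stuck hv hr' hr).mono (by simp only [stateCost]; omega) fun _ => id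
    | val v =>
      rcases st with _ | ⟨en, st⟩
      · rcases acts with _ | ⟨⟨st, E'⟩, acts⟩
        · rw [hr.focus.1]
          exact (sim_val_stuck hr' hr).mono (by omega) fun _ => id
        · exact moves _ _ (.esea7 _ _ _ _ _)
      · cases en with
        | code t => exact moves _ _ (.esea1 _ _ _ _ _)
        | val w =>
          cases v with
          | clos t vs =>
            cases w with
            | clos u ws =>
              rw [hr.focus.1]
              exact (sim_val_val_stuck (.inr ⟨_, _, rfl⟩) hr' hr).mono (by omega) fun _ => id
            | tup ws => exact moves _ _ (.beta _ _ _ _ _ _)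
          | tup vs =>
            rw [hr.focus.1]
            exact (sim_val_val_stuck (.inl ⟨_, rfl⟩) hr' hr).mono (by omega) fun _ => id
        | proj i =>
          cases v with
          | clos t vs =>
            rw [hr.focus.1]
            exact (sim_val_pi_stuck (.inl ⟨_, _, rfl⟩) hr' hr).mono (by omega) fun _ => id
          | tup vs =>
            cases hv : component vs i with
            | none =>
              rw [hr.focus.1]
              exact (sim_val_pi_stuck (.inr ⟨_, rfl, hv⟩) hr' hr).mono (by omega) fun _ => id
            | some v => exact moves _ _ (.pi _ _ _ _ _ _ hv)
        | part ts vs =>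
          rcases List.eq_nil_or_concat ts with rfl | ⟨ts, t, rfl⟩
          · exact moves _ _ (.esea3 _ _ _ _ _)
          · rw [List.concat_eq_append] at moves ⊢
            exact moves _ _ (.esea6 _ _ _ _ _ _ _)
  have := stateCost_pos σ
  obtain ⟨n, h1, h2, h3⟩ := hc.dispatch key
  exact ⟨n, by omega, h3⟩

theorem exists_atState_init {c : Config} {t : TTm} (h : Loaded c t) :
    ∃ n ≤ 13, ∃ c', exec machine n c = some c' ∧ AtState (init t) c' := by
  obtain ⟨pc, R, M⟩ := c
  obtain ⟨rfl, h⟩ := h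
  refine (reaches_init rfl rfl).mono le_rfl ?_
  rintro c ⟨hc, hm⟩
  have hM : Agree (R 1) M c.mem := hm ▸ ((Agree.refl _ M).update le_rfl).update (by omega)
  have m0 : c.mem (R 1) = 1 := by simp [hm]
  have m1 : c.mem (R 1 + 1) = 0 := by simp [hm]
  have hv : ValAt c.mem (R 1 + 2) (R 1) (.tup []) :=
    .tup _ _ (by simp) m0 m1 fun k hk => absurd hk (Nat.not_lt_zero k)
  exact ⟨_, _, _, _, _, _, _, hc, ⟨rfl, h.mono hM (by omega)⟩, rfl, ⟨hv, hv⟩, rfl⟩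

end RAM

/-! ## Weights -/

mutual
/-- A bound on the time that the evaluation of a term takes outside of called closures. -/
def TTm.weight : TTm → ℕ
  | .pvar _ => 1
  | .proj _ t => t.weight + 2
  | .tup ts => TTm.weightList ts + 2 * ts.length + 1
  | .app t u => t.weight + u.weight + 4
  | .clos _ b => b.length + 1
def TTm.weightList : List TTm → ℕ
  | [] => 0
  | t :: ts => t.weight + TTm.weightList ts
end

theorem TTm.weightList_append (ts us : List TTm) :
    TTm.weightList (ts ++ us) = TTm.weightList ts + TTm.weightList us := by
  induction ts with
  | nil => simp [TTm.weightList]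
  | cons t ts ih => simp [TTm.weightList, ih, Nat.add_assoc]

/-- The bodies of all closures in a term have weight at most `B`. -/
inductive TTm.BodiesLe (B : ℕ) : TTm → Prop
  | pvar (p : PVar) : BodiesLe B (.pvar p)
  | proj (i : ℕ) (t : TTm) : BodiesLe B t → BodiesLe B (.proj i t)
  | tup (ts : List TTm) : (∀ t ∈ ts, BodiesLe B t) → BodiesLe B (.tup ts)
  | app (t u : TTm) : BodiesLe B t → BodiesLe B u → BodiesLe B (.app t u)
  | clos (t : TTm) (b : List PVar) : t.weight ≤ B → BodiesLe B t → BodiesLe B (.clos t b)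

namespace TTAM

/-- The bodies of all closures in a value have weight at most `B`. -/
inductive Val.BodiesLe (B : ℕ) : Val → Prop
  | clos (t : TTm) (vs : List Val) : t.weight ≤ B → t.BodiesLe B → (∀ v ∈ vs, BodiesLe B v) →
      BodiesLe B (.clos t vs)
  | tup (vs : List Val) : (∀ v ∈ vs, BodiesLe B v) → BodiesLe B (.tup vs)

def Focus.BodiesLe (B : ℕ) : Focus → Prop
  | .code t => t.BodiesLe B
  | .val v => v.BodiesLe B

def Entry.BodiesLe (B : ℕ) : Entry → Prop
  | .code t => t.BodiesLe B
  | .val v => v.BodiesLe B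
  | .proj _ => True
  | .part ts vs => (∀ t ∈ ts, t.BodiesLe B) ∧ ∀ v ∈ vs, v.BodiesLe B

def Env.BodiesLe (B : ℕ) (E : Env) : Prop :=
  (∀ v ∈ E.l, v.BodiesLe B) ∧ ∀ v ∈ E.s, v.BodiesLe B

def State.BodiesLe (B : ℕ) (σ : State) : Prop :=
  σ.focus.BodiesLe B ∧ (∀ en ∈ σ.stack, en.BodiesLe B) ∧ σ.env.BodiesLe B ∧
    ∀ x ∈ σ.acts, (∀ en ∈ x.1, en.BodiesLe B) ∧ x.2.BodiesLe B

def Focus.weight : Focus → ℕ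
  | .code t => t.weight
  | .val _ => 0

/-- The constants prepay future transitions. A pending function costs one unit to be resumed and
leaves the 2 of its argument; these pay for `beta` and for the later pop of the activation stack.
Each pending tuple component carries 2, one for its own transition and one saved for copying its
value at the end. -/
def Entry.weight : Entry → ℕ
  | .code t => t.weight + 3
  | .val _ => 2
  | .proj _ => 1
  | .part ts vs => TTm.weightList ts + 2 * ts.length + vs.length + 1

def stackWeight (S : List Entry) : ℕ := (S.map Entry.weight).sum

def actsWeight (A : List (List Entry × Env)) : ℕ := (A.map fun x => stackWeight x.1 + 1).sum

/-- A potential that pays for the transitions up to the next `beta`. -/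
def State.weight (σ : State) : ℕ := σ.focus.weight + stackWeight σ.stack + actsWeight σ.acts

@[simp]
theorem stackWeight_nil : stackWeight [] = 0 := rfl

@[simp]
theorem stackWeight_cons (en : Entry) (S : List Entry) :
    stackWeight (en :: S) = en.weight + stackWeight S := rfl

@[simp]
theorem actsWeight_cons (x : List Entry × Env) (A : List (List Entry × Env)) :
    actsWeight (x :: A) = stackWeight x.1 + 1 + actsWeight A := rfl

/-- Lets the potential left at the end of a run pay for halting; the extra unit covers final states
of weight 0. -/
theorem stateCost_le (σ : State) : RAM.stateCost σ ≤ σ.weight + 1 := by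
  unfold RAM.stateCost
  split
  · simp only [State.weight, Focus.weight, TTm.weight]; omega
  · simp only [State.weight, stackWeight_cons, Entry.weight]; omega
  · omega

/-- The amortised inequality. `beta` releases the body of a closure, whose weight had not been
counted so far; every other transition redistributes the weight and loses at least its cost. -/
theorem weight_step {B : ℕ} {σ σ' : State} {α : Label} (hs : Step σ α σ') (hσ : σ.BodiesLe B) :
    σ'.weight + RAM.stateCost σ ≤ σ.weight + if α = .beta then B else 0 := by
  cases hs with
  | beta t vs ws S E A =>
    obtain ⟨hf, -⟩ := hσ
    cases hf with
    | clos _ _ h1 _ _ =>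
      simp only [State.weight, Focus.weight, stackWeight_cons, stackWeight_nil, actsWeight_cons,
        Entry.weight, RAM.stateCost, if_true]
      omega
  | esea6 v ts t vs S E A =>
    -- `stateCost` matches on an empty list, so `ts ++ [t]` has to be exposed as a cons first.
    have : RAM.stateCost ⟨.val v, .part (ts ++ [t]) vs :: S, E, A⟩ = 1 := by
      cases ts <;> rfl
    simp [State.weight, Focus.weight, Entry.weight, TTm.weightList_append, TTm.weightList, this]
    omega
  | _ =>
    simp [State.weight, Focus.weight, Entry.weight, TTm.weight, TTm.weightList_append,
      TTm.weightList, RAM.stateCost] <;> omega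

theorem component_mem {vs : List Val} {i : ℕ} {v : Val} (h : component vs i = some v) :
    v ∈ vs := by
  unfold component at h
  split_ifs at h
  exact List.mem_of_getElem? h

theorem Env.BodiesLe.lookup {B : ℕ} {E : Env} (hE : E.BodiesLe B) {p : PVar} {v : Val}
    (h : E.lookup p = some v) : v.BodiesLe B := by
  obtain ⟨x, i⟩ := p
  cases x with
  | l => exact hE.1 v (component_mem h)
  | s => exact hE.2 v (component_mem h)

/-- The subterm invariant: transitions only rearrange terms and values already present in the state,
so no new closure body is ever created. -/
theorem State.BodiesLe.step {B : ℕ} {σ σ' : State} {α : Label} (hs : Step σ α σ')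
    (hσ : σ.BodiesLe B) : σ'.BodiesLe B := by
  obtain ⟨hf, hS, hE, hA⟩ := hσ
  cases hs with
  | nsea1 t u S E A =>
    cases hf with
    | app _ _ h1 h2 => exact ⟨h2, List.forall_mem_cons.2 ⟨h1, hS⟩, hE, hA⟩
  | nsea2 i t S E A =>
    cases hf with
    | proj _ _ h => exact ⟨h, List.forall_mem_cons.2 ⟨trivial, hS⟩, hE, hA⟩
  | nsea3 ts t S E A =>
    cases hf with
    | tup _ h =>
      exact ⟨h t (by simp), List.forall_mem_cons.2
        ⟨⟨fun u hu => h u (by simp [hu]), by simp⟩, hS⟩, hE, hA⟩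
  | nsea4 S E A => exact ⟨.tup _ (by simp), hS, hE, hA⟩
  | subw t b vs S A E h =>
    cases hf with
    | clos _ _ h1 h2 =>
      refine ⟨.clos _ _ h1 h2 fun v hv => ?_, hS, hE, hA⟩
      obtain ⟨k, hk, rfl⟩ := List.getElem_of_mem hv
      exact hE.lookup (h.get (h.length_eq ▸ hk) hk)
  | subv p v S A E h => exact ⟨hE.lookup h, hS, hE, hA⟩
  | esea1 v t S E A =>
    obtain ⟨h1, h2⟩ := List.forall_mem_cons.1 hS
    exact ⟨h1, List.forall_mem_cons.2 ⟨hf, h2⟩, hE, hA⟩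
  | esea6 v ts t vs S E A =>
    obtain ⟨⟨h1, h2⟩, h3⟩ := List.forall_mem_cons.1 hS
    exact ⟨h1 t (by simp), List.forall_mem_cons.2
      ⟨⟨fun u hu => h1 u (by simp [hu]), List.forall_mem_cons.2 ⟨hf, h2⟩⟩, h3⟩, hE, hA⟩
  | esea3 v vs S E A =>
    obtain ⟨⟨h1, h2⟩, h3⟩ := List.forall_mem_cons.1 hS
    exact ⟨.tup _ (List.forall_mem_cons.2 ⟨hf, h2⟩), h3, hE, hA⟩
  | pi vs i v S E A h =>
    cases hf with
    | tup _ h1 => exact ⟨h1 v (component_mem h), (List.forall_mem_cons.1 hS).2, hE, hA⟩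
  | beta t vs ws S E A =>
    obtain ⟨h1, h2⟩ := List.forall_mem_cons.1 hS
    cases hf with
    | clos _ _ h3 h4 h5 =>
      cases h1 with
      | tup _ h6 => exact ⟨h4, by simp, ⟨h5, h6⟩, List.forall_mem_cons.2 ⟨⟨h2, hE⟩, hA⟩⟩
  | esea7 v S E E' A =>
    obtain ⟨⟨h1, h2⟩, h3⟩ := List.forall_mem_cons.1 hA
    exact ⟨hf, h1, h2, h3⟩

end TTAM

/-! ## Closure conversion -/

theorem Enumerates.length_eq {e : Src → List ℕ} (he : Enumerates e) (t : Src) :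
    (e t).length = t.fv.card := by
  rw [← (he t).2, List.toFinset_card_of_nodup (he t).1]

theorem Src.card_fv_le_lam (xs : List ℕ) (t : Src) :
    t.fv.card ≤ (Src.lam xs t).fv.card + xs.length := by
  have h : t.fv ⊆ (Src.lam xs t).fv ∪ xs.toFinset := by
    intro x hx
    by_cases hxs : x ∈ xs.toFinset
    · exact Finset.mem_union_right _ hxs
    · exact Finset.mem_union_left _ (by simp only [Src.fv]; exact Finset.mem_sdiff.2 ⟨hx, hxs⟩)
  calc t.fv.card ≤ _ := Finset.card_le_card h
    _ ≤ _ := Finset.card_union_le _ _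
    _ ≤ _ := Nat.add_le_add_left (List.toFinset_card_le _) _

mutual
-- The quantity `fv.card + height` does not increase towards subterms: going under a binder frees at
-- most as many variables as the height loses. It thus bounds the length of every bag by `H`. The
-- summand 1 in `6 * size + 1` is there for the empty tuple, of size 0 and weight 1. The parameter
-- `N` makes the bound on bodies uniform over all subterms.
theorem Src.weight_elim_wrap {e : Src → List ℕ} (he : Enumerates e) {H N : ℕ} :
    ∀ (t : Src) (ys xs : List ℕ), t.fv.card + t.height ≤ H → t.size ≤ N →
      ((t.wrap e).elim ys xs).weight ≤ (6 * t.size + 1) * (H + 1) ∧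
      ((t.wrap e).elim ys xs).BodiesLe ((6 * N + 1) * (H + 1))
  | .var x, ys, xs, _, _ => by
    simp only [Src.wrap, ITm.elim, TTm.weight, Src.size]
    exact ⟨by omega, .pvar _⟩
  | .lam ws t, ys, xs, hH, hN => by
    have h1 := Src.card_fv_le_lam ws t
    have h2 := he.length_eq (.lam ws t)
    simp only [Src.height, Src.size] at hH hN
    obtain ⟨h3, h4⟩ := Src.weight_elim_wrap he t (e (.lam ws t)) ws (H := H) (N := N)
      (by omega) (by omega)
    simp only [Src.wrap, ITm.elim, TTm.weight, Src.size, List.length_map]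
    refine ⟨?_, .clos _ _ (h3.trans (Nat.mul_le_mul_right _ (by omega))) h4⟩
    calc (e (.lam ws t)).length + 1 ≤ 1 * (H + 1) := by omega
      _ ≤ _ := Nat.mul_le_mul_right _ (by omega)
  | .app t u, ys, xs, hH, hN => by
    simp only [Src.height, Src.size, Src.fv] at hH hN
    have h1 := Finset.card_le_card (Finset.subset_union_left (s₁ := t.fv) (s₂ := u.fv))
    have h2 := Finset.card_le_card (Finset.subset_union_right (s₁ := t.fv) (s₂ := u.fv))
    obtain ⟨h3, h4⟩ := Src.weight_elim_wrap he t ys xs (H := H) (N := N) (by omega) (by omega)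
    obtain ⟨h5, h6⟩ := Src.weight_elim_wrap he u ys xs (H := H) (N := N) (by omega) (by omega)
    simp only [Src.wrap, ITm.elim, TTm.weight, Src.size]
    exact ⟨by nlinarith, .app _ _ h4 h6⟩
  | .proj i t, ys, xs, hH, hN => by
    simp only [Src.height, Src.size, Src.fv] at hH hN
    obtain ⟨h3, h4⟩ := Src.weight_elim_wrap he t ys xs (H := H) (N := N) (by omega) (by omega)
    simp only [Src.wrap, ITm.elim, TTm.weight, Src.size]
    exact ⟨by nlinarith, .proj _ _ h4⟩
  | .tup ts, ys, xs, hH, hN => by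
    simp only [Src.height, Src.size, Src.fv] at hH hN
    obtain ⟨h3, h4, h5⟩ := Src.weight_elimList_wrapList he ts ys xs (H := H) (N := N)
      (by omega) (by omega)
    simp only [Src.wrap, ITm.elim, TTm.weight, Src.size, h4]
    exact ⟨by nlinarith, .tup _ h5⟩
-- The term `ts.length` collects the summand 1 of each component; the size of a tuple, which counts
-- its components, absorbs it.
theorem Src.weight_elimList_wrapList {e : Src → List ℕ} (he : Enumerates e) {H N : ℕ} :
    ∀ (ts : List Src) (ys xs : List ℕ),
      (Src.fvList ts).card + Src.heightList ts ≤ H → Src.sizeList ts ≤ N →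
      TTm.weightList (ITm.elimList (Src.wrapList e ts) ys xs) ≤
        (6 * Src.sizeList ts + ts.length) * (H + 1) ∧
      (ITm.elimList (Src.wrapList e ts) ys xs).length = ts.length ∧
      ∀ t ∈ ITm.elimList (Src.wrapList e ts) ys xs, t.BodiesLe ((6 * N + 1) * (H + 1))
  | [], ys, xs, _, _ => by simp [Src.wrapList, ITm.elimList, TTm.weightList]
  | t :: ts, ys, xs, hH, hN => by
    simp only [Src.heightList, Src.sizeList, Src.fvList] at hH hN
    have h1 := Finset.card_le_card
      (Finset.subset_union_left (s₁ := t.fv) (s₂ := Src.fvList ts))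
    have h2 := Finset.card_le_card
      (Finset.subset_union_right (s₁ := t.fv) (s₂ := Src.fvList ts))
    obtain ⟨h3, h4⟩ := Src.weight_elim_wrap he t ys xs (H := H) (N := N) (by omega) (by omega)
    obtain ⟨h5, h6, h7⟩ := Src.weight_elimList_wrapList he ts ys xs (H := H) (N := N)
      (by omega) (by omega)
    simp only [Src.wrapList, ITm.elimList, TTm.weightList, Src.sizeList, List.length_cons, h6]
    exact ⟨by nlinarith, trivial, List.forall_mem_cons.2 ⟨h4, h7⟩⟩
end

-- Total running time

namespace TTAM

theorem State.BodiesLe.init {B : ℕ} {t : TTm} (h : t.BodiesLe B) : (init t).BodiesLe B :=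
  ⟨h, by simp [TTAM.init], by simp [TTAM.init, Env.BodiesLe], by simp [TTAM.init]⟩

/-- The number of `beta` transitions among the first `m` transitions of a run. -/
def Run.betasBefore {s : State} (ρ : Run s) (m : ℕ) : ℕ :=
  ((Finset.range m).filter fun k => ρ.label k = .beta).card

theorem Run.betasBefore_succ {s : State} (ρ : Run s) (m : ℕ) :
    ρ.betasBefore (m + 1) = ρ.betasBefore m + if ρ.label m = .beta then 1 else 0 := by
  unfold Run.betasBefore
  rw [Finset.range_add_one, Finset.filter_insert]
  split_ifs
  · rw [Finset.card_insert_of_notMem (by simp)]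
  · rfl

end TTAM

namespace RAM

open TTAM

/-- Elapsed time plus 101 times the current potential grows only at `beta` transitions, by at most
`101 * B` each; the 13 is the initialisation. The invariant on bodies is carried along since
`weight_step` needs it. -/
theorem exists_times {t : TTm} {B : ℕ} (ht : t.BodiesLe B) (ρ : Run (init t)) {c₀ : Config}
    (h₀ : Loaded c₀ t) (m : ℕ) (hm : m ≤ ρ.len) :
    ∃ τ : ℕ → ℕ, (∀ k < m, τ k < τ (k + 1)) ∧
      (∀ k ≤ m, ∃ c, exec machine (τ k) c₀ = some c ∧ AtState (ρ.state k) c) ∧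
      (ρ.state m).BodiesLe B ∧
      τ m + 101 * (ρ.state m).weight ≤ 13 + 101 * (t.weight + B * ρ.betasBefore m) := by
  induction m with
  | zero =>
    obtain ⟨n, hn, h⟩ := exists_atState_init h₀
    refine ⟨fun _ => n, fun k hk => absurd hk (Nat.not_lt_zero k), fun k hk => ?_, ?_, ?_⟩
    · rw [Nat.le_zero.1 hk, ρ.start]
      exact h
    · rw [ρ.start]
      exact .init ht
    · rw [ρ.start]
      have : (init t).weight = t.weight := rfl
      rw [this, show ρ.betasBefore 0 = 0 from rfl, Nat.mul_zero]
      exact Nat.add_le_add_right hn _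
  | succ m ih =>
    obtain ⟨τ, h1, h2, h3, h4⟩ := ih (by omega)
    have hs := ρ.step m hm
    obtain ⟨c, hc, hat⟩ := h2 m le_rfl
    obtain ⟨n, hn, hn', c', hc', hat'⟩ := hat.step hs
    have hw := weight_step hs h3
    refine ⟨Function.update τ (m + 1) (τ m + n), fun k hk => ?_, fun k hk => ?_,
      h3.step hs, ?_⟩
    · rw [Function.update_of_ne (by omega)]
      rcases Nat.lt_succ_iff_lt_or_eq.1 hk with hk | rfl
      · rw [Function.update_of_ne (by omega)]
        exact h1 k hk
      · rw [Function.update_self]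
        omega
    · rcases Nat.le_succ_iff.1 hk with hk | rfl
      · rw [Function.update_of_ne (by omega)]
        exact h2 k hk
      · refine ⟨c', ?_, hat'⟩
        rw [Function.update_self, exec_add, hc]
        exact hc'
    · rw [Function.update_self, ρ.betasBefore_succ]
      split_ifs at hw ⊢
      · rw [Nat.mul_succ B]
        omega
      · rw [Nat.add_zero (ρ.betasBefore m)]
        omega

/-- Halting costs at most 101 times the final weight plus one. The remaining potential pays for the
weight, and 114 is the initial 13 plus 101. -/
theorem implements_machine {t : TTm} {B : ℕ} (ht : t.BodiesLe B) (ρ : Run (init t))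
    (hρ : ρ.Complete) {c₀ : Config} (h₀ : Loaded c₀ t) :
    Implements machine c₀ ρ (114 + 101 * (t.weight + B * ρ.betas)) := by
  obtain ⟨τ, h1, h2, h3, h4⟩ := exists_times ht ρ h₀ ρ.len le_rfl
  obtain ⟨c, hc, hat⟩ := h2 ρ.len le_rfl
  obtain ⟨n, hn, c', hc', hst, hrep⟩ := hat.halts hρ
  have hcost := stateCost_le (ρ.state ρ.len)
  refine ⟨τ, τ ρ.len + n, h1, Nat.le_add_right _ _, ?_, fun k hk => ?_, c', ?_, hst, hrep⟩
  · change _ ≤ 114 + 101 * (t.weight + B * ρ.betasBefore ρ.len)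
    have hn' : n ≤ 101 * stateCost (ρ.state ρ.len) := hn
    omega
  · obtain ⟨c, hc, hat⟩ := h2 k hk
    exact ⟨c, hc, hat.represents⟩
  · rw [exec_add, hc]
    exact hc'

theorem Implements.mono {P : List Instr} {c₀ : Config} {s : State} {ρ : Run s} {T T' : ℕ}
    (h : Implements P c₀ ρ T) (hT : T ≤ T') : Implements P c₀ ρ T' := by
  obtain ⟨τ, n, h1, h2, h3, h4⟩ := h
  exact ⟨τ, n, h1, h2, h3.trans hT, h4⟩

end RAM

theorem mainTheorem10 :
    ∃ (P : List RAM.Instr) (C : ℕ),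
      ∀ (e : Src → List ℕ), Enumerates e →
      ∀ t : Src, t.Proper → t.Closed →
      ∀ ρ : TTAM.Run (TTAM.init (t.closureConversion e)), ρ.Complete →
      ∀ c₀ : RAM.Config, RAM.Loaded c₀ (t.closureConversion e) →
        RAM.Implements P c₀ ρ (C * ((ρ.betas + 1) * (t.size + 1) * (t.height + 1))) := by
  -- 720 is 114 + 6 · 101: the weights contribute at most six times the product in the bound, and
  -- the constant 114 is absorbed because that product is at least 1.
  refine ⟨RAM.machine, 720, fun e he t _ ht ρ hρ c₀ h₀ => ?_⟩
  -- This is where closedness enters: without free variables, `H` can be taken to be the height.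
  have hH : t.fv.card + t.height ≤ t.height := by
    rw [show t.fv = ∅ from ht, Finset.card_empty, Nat.zero_add]
  obtain ⟨hw, hb⟩ := Src.weight_elim_wrap he t [] [] hH le_rfl
  refine (RAM.implements_machine (t := t.closureConversion e) hb ρ hρ h₀).mono ?_
  have hw' : (t.closureConversion e).weight ≤ (6 * t.size + 1) * (t.height + 1) := hw
  generalize (t.closureConversion e).weight = w at hw'
  have hB : (6 * t.size + 1) * (t.height + 1) ≤ 6 * ((t.size + 1) * (t.height + 1)) := by
    rw [← Nat.mul_assoc]
    exact Nat.mul_le_mul_right _ (by omega)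
  have h1 : 1 ≤ (ρ.betas + 1) * (t.size + 1) * (t.height + 1) := by
    exact Nat.succ_le_of_lt (by positivity)
  have h2 : w + (6 * t.size + 1) * (t.height + 1) * ρ.betas ≤
      6 * ((ρ.betas + 1) * (t.size + 1) * (t.height + 1)) := by
    calc _ ≤ (6 * t.size + 1) * (t.height + 1) * (ρ.betas + 1) := by
          rw [Nat.mul_succ _ ρ.betas]; omega
      _ ≤ 6 * ((t.size + 1) * (t.height + 1)) * (ρ.betas + 1) := Nat.mul_le_mul_right _ hB
      _ = _ := by ring
  omega
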